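/- All graphs are finite and loopless; multiple edges are allowed. Let $m\ge 1$ be an integer. A graph is called *$m$-tree-connected* if it has $m$ pairwise edge-disjoint spanning trees (a spanning tree has at least one vertex, so the graph with no vertices is not $m$-tree-connected). The *$m$-tree-connected components* of a graph $G$ are its maximal induced $m$-tree-connected subgraphs; their vertex sets form a partition $P$ of $V(G)$, and one puts $$\Omega_m(G)=|P|-\frac1m\,e_G(P),$$ where $e_G(P)$ is the number of edges of $G$ whose ends lie in different parts of $P$ (so $\Omega_m=0$ for the graph with no vertices). For $S\subseteq V(G)$, let $G\setminus S$ be the graph obtained from $G$ by deleting the vertices of $S$, and let $e_G(S)$ be the number of edges of $G$ with both ends in $S$. Let $d_H(v)$ denote the degree of $v$ in $H$. **Theorem.** Let $G$ be an $m$-tree-connected graph and let $X\subseteq V(G)$. Let $\lambda\in[0,1/m]$ be a real number and let $\eta:X\to\bigl(m\lambda+\frac{m-1}{m},\,\infty\bigr)$ be a real function. Suppose that for all $S\subseteq X$, $$\Omega_m(G\setminus S)<\frac1m+\sum_{v\in S}\bigl(\eta(v)-2\bigr)+2-\lambda\bigl(e_G(S)+m\bigr).$$ Then $G$ has an $m$-tree-connected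 spanning subgraph $H$ such that for every $v\in X$, $$d_H(v)\le\bigl\lceil m\eta(v)-m^2\lambda\bigr\rceil.$$ -/

import Mathlib

open scoped Graph

noncomputable section

namespace Graph

variable {α β : Type*}

/-- `G` is connected: it has a vertex, and any two vertices are joined by a walk. -/
def IsConnected (G : Graph α β) : Prop :=
  V(G).Nonempty ∧ ∀ x ∈ V(G), ∀ y ∈ V(G), Relation.ReflTransGen G.Adj x y

/-- `v 0, e 0, v 1, e 1, …, v n, e n, v 0` is a cycle of `G` with `n + 1` distinct vertices and
`n + 1` distinct edges (addition in `Fin (n + 1)` is cyclic; `n = 0` is a loop, `n = 1` a pair of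
parallel edges). -/
def IsCycle (G : Graph α β) (n : ℕ) (v : Fin (n + 1) → α) (e : Fin (n + 1) → β) : Prop :=
  Function.Injective v ∧ Function.Injective e ∧ ∀ i, G.IsLink (e i) (v i) (v (i + 1))

/-- A tree is a connected graph without cycles. -/
def IsTree (G : Graph α β) : Prop :=
  G.IsConnected ∧ ∀ (n : ℕ) (v : Fin (n + 1) → α) (e : Fin (n + 1) → β), ¬ G.IsCycle n v e

/-- `G` is `m`-tree-connected: it has `m` pairwise edge-disjoint spanning trees. -/
def IsTreeConnected (G : Graph α β) (m : ℕ) : Prop :=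
  ∃ T : Fin m → Graph α β,
    (∀ i, (T i).IsSpanningSubgraph G ∧ (T i).IsTree) ∧
    ∀ i j, i ≠ j → Disjoint E(T i) E(T j)

/-- The vertex sets of the `m`-tree-connected components of `G`, that is, of the maximal induced
`m`-tree-connected subgraphs of `G`. -/
def treeComponents (G : Graph α β) (m : ℕ) : Set (Set α) :=
  {C | Maximal (fun D : Set α => D ⊆ V(G) ∧ (G.induce D).IsTreeConnected m) C}

/-- `e_G(P)`: the number of edges of `G` whose ends lie in different members of `P`. -/
def numCrossing (G : Graph α β) (P : Set (Set α)) : ℕ :=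
  {e : β | ∃ x y, G.IsLink e x y ∧ ∃ A ∈ P, ∃ B ∈ P, A ≠ B ∧ x ∈ A ∧ y ∈ B}.ncard

/-- `Ω_m(G) = |P| - e_G(P) / m`, where `P` is the partition of `V(G)` into the vertex sets of the
`m`-tree-connected components of `G`. -/
def Omega (m : ℕ) (G : Graph α β) : ℝ :=
  ((G.treeComponents m).ncard : ℝ) - (1 / (m : ℝ)) * (G.numCrossing (G.treeComponents m) : ℝ)

/-- `e_G(S)`: the number of edges of `G` with both ends in `S`. -/
def numInside (G : Graph α β) (S : Set α) : ℕ :=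
  {e : β | ∃ x y, G.IsLink e x y ∧ x ∈ S ∧ y ∈ S}.ncard

/-- The degree of `v` in a loopless graph: the number of edges incident with `v`. -/
def degree (G : Graph α β) (v : α) : ℕ :=
  (G.incidenceSet v).ncard

end Graph

end

/-! Fix integer degree bounds `h`: the required ceiling on `X`, an unattainable value elsewhere.
Call an edge set sparse if every nonempty vertex set `W` spans at most m(|W|-1) of its edges, and
`W` tight on equality. Unions of m edge-disjoint spanning trees correspond to the sparse sets of
m(|V|-1) edges, here called bases (Nash-Williams, by `IsSparse.exists_coloring` and
`connects_of_tight`). Tight sets that meet are closed under union and intersection, and the least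
tight set around a new edge shows which edges may be exchanged for it.

Take a base H of least total excess over `h` and suppose that some vertex of `X` violates its bound.
Start with the violating vertices and repeatedly add those whose degree no rearrangement inside a
tight set avoiding the current set brings below the bound. The limit S (`exists_saturated_set`)
consists of vertices with degree at least `h`, and each edge of G - S outside H lies in a tight set
avoiding S. Otherwise both ends of such an edge could be given room, the edge inserted, and an edge
removed at a vertex that minimality or saturation protects (`exists_rearrangement_of_crossing`).

Hence each m-tree-connected component of G - S is spanned by H as tightly as possible and all
crossing edges belong to H, so m Ω(G - S) is at least m|V - S| - e_H(V - S)
(`Graph.mul_card_add_numCrossing_le`). Counting the edges of H by their ends in S, with e_H(S) at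
most m(|S|-1) and at least one strict violation in S, contradicts the hypothesis for S
(`bound_le_of_counts`). -/

/-! ### Matroid partition for families of vectors. -/

section MatroidPartition

variable {K M β : Type*} [Field K] [AddCommGroup M] [Module K M] {v : β → M}

/-- A vector in the span of an independent family lies in the span of those members for which it
can be exchanged. -/
theorem mem_span_image_of_exchangeable {I A : Set β} {e : β} (hI : LinearIndepOn K v I)
    (he : v e ∈ Submodule.span K (v '' I))
    (hA : ∀ f ∈ I, LinearIndepOn K v (insert e (I \ {f})) → f ∈ A) :
    v e ∈ Submodule.span K (v '' (A ∩ I)) := by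
  classical
  obtain ⟨l, hl, hle⟩ := (Finsupp.mem_span_image_iff_linearCombination K).1 he
  rw [← hle, Finsupp.linearCombination_apply, Finsupp.sum]
  refine Submodule.sum_mem _ fun f hf => ?_
  refine Submodule.smul_mem _ _ (Submodule.subset_span ⟨f, ⟨?_, ?_⟩, rfl⟩)
  swap
  · exact (Finsupp.mem_supported K l).1 hl hf
  have hfI : f ∈ I := (Finsupp.mem_supported K l).1 hl hf
  refine hA f hfI ?_
  -- If the exchange failed, `v e` would lie in the span of `I \ {f}`; solving the relation for `v
  -- f`, whose coefficient is nonzero, would put `v f` there too.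
  refine (hI.mono Set.sdiff_subset).insert fun hes => ?_
  have hfI' := hI.notMem_span hfI
  apply hfI'
  have hlf : l f ≠ 0 := Finsupp.mem_support_iff.1 hf
  have h1 : l f • v f = v e - ∑ g ∈ l.support.erase f, l g • v g := by
    rw [← hle, Finsupp.linearCombination_apply, Finsupp.sum, ← Finset.add_sum_erase _ _ hf]
    abel
  have h2 : l f • v f ∈ Submodule.span K (v '' (I \ {f})) := by
    rw [h1]
    refine Submodule.sub_mem _ hes (Submodule.sum_mem _ fun g hg => Submodule.smul_mem _ _
      (Submodule.subset_span ⟨g, ⟨?_, ?_⟩, rfl⟩))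
    · exact (Finsupp.mem_supported K l).1 hl (Finset.mem_of_mem_erase hg)
    · exact Finset.ne_of_mem_erase hg
  exact (Submodule.smul_mem_iff _ hlf).1 h2

/-- The colour class `i` of `c` on `F`, the element `e` being left uncoloured. -/
def colorClass {m : ℕ} (F : Set β) (e : β) (c : β → Fin m) (i : Fin m) : Set β :=
  {f | f ∈ F ∧ f ≠ e ∧ c f = i}

theorem colorClass_update_self {m : ℕ} [DecidableEq β] {F : Set β} {e f : β} {c : β → Fin m}
    (heF : e ∈ F) (hfe : f ≠ e) :
    colorClass F f (Function.update c e (c f)) (c f) =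
      insert e (colorClass F e c (c f) \ {f}) := by
  ext g
  by_cases hg : g = e
  · subst hg; simp [colorClass, heF, hfe.symm]
  · simp [colorClass, hg]; tauto

theorem colorClass_update_of_ne {m : ℕ} [DecidableEq β] {F : Set β} {e f : β} {c : β → Fin m}
    {j : Fin m} (hj : j ≠ c f) :
    colorClass F f (Function.update c e (c f)) j = colorClass F e c j := by
  ext g
  by_cases hg : g = e
  · subst hg; simp [colorClass, hj.symm]
  · simp only [colorClass, Function.update_of_ne hg, Set.mem_ofPred_eq]
    constructor
    · rintro ⟨h1, -, h3⟩; exact ⟨h1, hg, h3⟩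
    · rintro ⟨h1, -, h3⟩; exact ⟨h1, fun h => hj (by rw [← h3, h]), h3⟩

/-- One exchange step between partial colourings by independent sets: the uncoloured element
`p.1` receives the colour of `q.1`, which becomes uncoloured. -/
def ExchangeStep (K : Type*) {M β : Type*} [Field K] [AddCommGroup M] [Module K M] {m : ℕ}
    [DecidableEq β] (v : β → M) (F : Set β) (p q : β × (β → Fin m)) : Prop :=
  q.1 ∈ F ∧ q.1 ≠ p.1 ∧ q.2 = Function.update p.2 p.1 (p.2 q.1) ∧
    ∀ i, LinearIndepOn K v (colorClass F q.1 q.2 i)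

/-- Matroid partition for vector families: a colouring of `F \ {e}` by independent classes either
can be rearranged to a colouring of `F`, or there is a set `A` containing `e` that is spanned by
each of the colour classes inside `A`. -/
theorem exists_independent_coloring_or_obstruction {m : ℕ} {F : Set β} {e₀ : β}
    {c₀ : β → Fin m} (he₀ : e₀ ∈ F) (hc₀ : ∀ i, LinearIndepOn K v (colorClass F e₀ c₀ i)) :
    (∃ c : β → Fin m, ∀ i, LinearIndepOn K v {f | f ∈ F ∧ c f = i}) ∨
    ∃ A ⊆ F, e₀ ∈ A ∧
      ∀ i, ∀ f ∈ A, v f ∈ Submodule.span K (v '' (A ∩ colorClass F e₀ c₀ i)) := by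
  classical
  by_cases hcol : ∃ c : β → Fin m, ∀ i, LinearIndepOn K v {f | f ∈ F ∧ c f = i}
  · exact Or.inl hcol
  right
  let R := Relation.ReflTransGen (ExchangeStep K (m := m) v F) (e₀, c₀)
  -- The obstruction is the set of all elements that exchanges can make the uncoloured one.
  let A : Set β := {f | ∃ c, R (f, c)}
  have valid : ∀ p, R p → p.1 ∈ F ∧ ∀ i, LinearIndepOn K v (colorClass F p.1 p.2 i) := by
    intro p hp
    induction hp with
    | refl => exact ⟨he₀, hc₀⟩
    | tail _ h _ => exact ⟨h.1, h.2.2.2⟩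
  have step : ∀ p, R p → ∀ f ∈ colorClass F p.1 p.2 (p.2 f),
      LinearIndepOn K v (insert p.1 (colorClass F p.1 p.2 (p.2 f) \ {f})) →
      R (f, Function.update p.2 p.1 (p.2 f)) := by
    intro p hp f hf hind
    refine hp.tail ⟨hf.1, hf.2.1, rfl, fun j => ?_⟩
    by_cases hj : j = p.2 f
    · subst hj
      rw [colorClass_update_self (valid p hp).1 hf.2.1]
      exact hind
    · rw [colorClass_update_of_ne hj]
      exact (valid p hp).2 j
  -- The uncoloured element is spanned by every class, since otherwise it could be coloured. The
  -- members exchangeable for it belong to `A` by definition.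
  have hole : ∀ p, R p → ∀ i, v p.1 ∈ Submodule.span K (v '' (A ∩ colorClass F p.1 p.2 i)) := by
    intro p hp i
    obtain ⟨hpF, hind⟩ := valid p hp
    refine mem_span_image_of_exchangeable (hind i) ?_ ?_
    · by_contra hns
      apply hcol
      refine ⟨Function.update p.2 p.1 i, fun j => ?_⟩
      by_cases hj : j = i
      · subst hj
        convert (hind j).insert hns using 1
        ext g
        by_cases hg : g = p.1
        · subst hg; simp [hpF]
        · simp [colorClass, hg]
      · convert hind j using 1
        ext g
        by_cases hg : g = p.1
        · subst hg; simp [colorClass, Ne.symm hj]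
        · simp [colorClass, hg]
    · intro f hf hf'
      have hfi : p.2 f = i := hf.2.2
      subst hfi
      exact ⟨_, step p hp f hf hf'⟩
  -- An exchange adds to a class only an element already spanned by its part in `A`, so these spans
  -- never grow and everything refers back to `c₀`.
  have inv : ∀ p, R p → ∀ i, Submodule.span K (v '' (A ∩ colorClass F p.1 p.2 i)) ≤
      Submodule.span K (v '' (A ∩ colorClass F e₀ c₀ i)) := by
    intro p hp
    induction hp with
    | refl => intro i; exact le_rfl
    | @tail p q hp hpq ih =>
      intro i
      obtain ⟨hqF, hqp, hq2, -⟩ := hpq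
      refine le_trans ?_ (ih i)
      by_cases hi : i = p.2 q.1
      · subst hi
        rw [hq2, colorClass_update_self (valid p hp).1 hqp, Submodule.span_le]
        rintro _ ⟨g, ⟨hgA, rfl | hg⟩, rfl⟩
        · exact hole p hp _
        · exact Submodule.subset_span ⟨g, ⟨hgA, hg.1⟩, rfl⟩
      · rw [hq2, colorClass_update_of_ne hi]
  refine ⟨A, fun f ⟨c, hc⟩ => (valid _ hc).1, ⟨c₀, .refl⟩, ?_⟩
  rintro i f ⟨c, hc⟩
  exact inv _ hc i (hole _ hc i)

end MatroidPartition

/-! ### Incidence vectors, connectivity and forests. -/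

section EdgeVectors

variable {K M ι : Type*} [Field K] [AddCommGroup M] [Module K M] {v : ι → M}

theorem finrank_span_image_finset_le (F : Finset ι) :
    Module.finrank K (Submodule.span K (v '' (F : Set ι))) ≤ F.card := by
  have h := finrank_range_le_card (R := K) (fun x : F => v x)
  have hr : Set.range (fun x : F => v x) = v '' F := by ext; simp
  rw [hr] at h
  simpa [Set.finrank] using h

theorem LinearIndepOn.finrank_span_image_finset {F : Finset ι}
    (h : LinearIndepOn K v (F : Set ι)) :
    Module.finrank K (Submodule.span K (v '' (F : Set ι))) = F.card := by
  have h' := finrank_span_eq_card (R := K) (b := fun x : F => v x) h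
  have hr : Set.range (fun x : F => v x) = v '' F := by ext; simp
  rw [hr] at h'
  simpa using h'

variable {α β : Type*} {s t : β → α}

/-- The incidence vector of the edge `e` with ends `s e` and `t e`. -/
noncomputable def edgeVec (s t : β → α) (e : β) : α →₀ ℚ :=
  Finsupp.single (s e) 1 - Finsupp.single (t e) 1

/-- The vertices `x` and `y` are joined by the edges in `F`, expressed by incidence vectors. -/
def EdgeJoined (s t : β → α) (F : Set β) (x y : α) : Prop :=
  (Finsupp.single x 1 - Finsupp.single y 1 : α →₀ ℚ) ∈ Submodule.span ℚ (edgeVec s t '' F)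

theorem EdgeJoined.refl (F : Set β) (x : α) : EdgeJoined s t F x x := by simp [EdgeJoined]

theorem EdgeJoined.symm {F : Set β} {x y : α} (h : EdgeJoined s t F x y) : EdgeJoined s t F y x := by
  unfold EdgeJoined at *
  rw [← neg_sub]
  exact Submodule.neg_mem _ h

theorem EdgeJoined.trans {F : Set β} {x y z : α} (h : EdgeJoined s t F x y) (h' : EdgeJoined s t F y z) :
    EdgeJoined s t F x z := by
  unfold EdgeJoined at *
  rw [← sub_add_sub_cancel]
  exact Submodule.add_mem _ h h'

theorem EdgeJoined.of_mem {F : Set β} {e : β} (he : e ∈ F) : EdgeJoined s t F (s e) (t e) :=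
  Submodule.subset_span ⟨e, he, rfl⟩

theorem EdgeJoined.of_forall {F F' : Set β} {x y : α} (h : EdgeJoined s t F x y)
    (hF : ∀ e ∈ F, EdgeJoined s t F' (s e) (t e)) : EdgeJoined s t F' x y := by
  refine Submodule.span_le.2 ?_ h
  rintro _ ⟨e, he, rfl⟩
  exact hF e he

theorem EdgeJoined.mono {F F' : Set β} {x y : α} (h : EdgeJoined s t F x y) (hF : F ⊆ F') :
    EdgeJoined s t F' x y :=
  h.of_forall fun _ he => .of_mem (hF he)

/-- Adjacency by an edge in `F`. -/
def LinkedBy (s t : β → α) (F : Set β) (x y : α) : Prop :=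
  ∃ e ∈ F, (s e = x ∧ t e = y) ∨ (s e = y ∧ t e = x)

theorem LinkedBy.joined {F : Set β} {x y : α} (h : LinkedBy s t F x y) : EdgeJoined s t F x y := by
  obtain ⟨e, he, ⟨rfl, rfl⟩ | ⟨rfl, rfl⟩⟩ := h
  · exact .of_mem he
  · exact (EdgeJoined.of_mem he).symm

theorem joined_of_reflTransGen {F : Set β} {x y : α}
    (h : Relation.ReflTransGen (LinkedBy s t F) x y) : EdgeJoined s t F x y := by
  induction h with
  | refl => exact .refl _ _
  | tail _ h ih => exact ih.trans h.joined

/-- The functional adding up the coefficients at vertices reachable from `x` kills every edge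
vector, but is 1 on the vector of the pair if `y` is unreachable. -/
theorem EdgeJoined.reflTransGen {F : Set β} {x y : α} (h : EdgeJoined s t F x y) :
    Relation.ReflTransGen (LinkedBy s t F) x y := by
  classical
  let φ : (α →₀ ℚ) →ₗ[ℚ] ℚ :=
    Finsupp.linearCombination ℚ fun z => if Relation.ReflTransGen (LinkedBy s t F) x z then 1 else 0
  have hφ : ∀ u ∈ Submodule.span ℚ (edgeVec s t '' F), φ u = 0 := by
    intro u hu
    have : Submodule.span ℚ (edgeVec s t '' F) ≤ LinearMap.ker φ := by
      rw [Submodule.span_le]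
      rintro _ ⟨e, he, rfl⟩
      have : Relation.ReflTransGen (LinkedBy s t F) x (s e) ↔
          Relation.ReflTransGen (LinkedBy s t F) x (t e) :=
        ⟨fun h => h.tail ⟨e, he, Or.inl ⟨rfl, rfl⟩⟩, fun h => h.tail ⟨e, he, Or.inr ⟨rfl, rfl⟩⟩⟩
      simp [φ, edgeVec, this]
    exact this hu
  have h0 := hφ _ h
  by_contra hxy
  simp [φ, hxy, Relation.ReflTransGen.refl] at h0

theorem EdgeJoined.inter_of_closed {F : Set β} {U : Set α} {x y : α} (h : EdgeJoined s t F x y)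
    (hx : x ∈ U) (hU : ∀ e ∈ F, s e ∈ U ↔ t e ∈ U) :
    EdgeJoined s t (F ∩ {e | s e ∈ U ∧ t e ∈ U}) x y := by
  suffices y ∈ U ∧ EdgeJoined s t (F ∩ {e | s e ∈ U ∧ t e ∈ U}) x y from this.2
  have h' := h.reflTransGen
  clear h
  induction h' with
  | refl => exact ⟨hx, .refl _ _⟩
  | tail _ h ih =>
    obtain ⟨hb, hj⟩ := ih
    obtain ⟨e, he, ⟨rfl, rfl⟩ | ⟨rfl, rfl⟩⟩ := h
    · exact ⟨(hU e he).1 hb, hj.trans (.of_mem ⟨he, hb, (hU e he).1 hb⟩)⟩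
    · have hF : e ∈ F ∩ {e | s e ∈ U ∧ t e ∈ U} := ⟨he, (hU e he).2 hb, hb⟩
      exact ⟨(hU e he).2 hb, hj.trans (EdgeJoined.of_mem hF).symm⟩

/-- The edges in `F` join any two vertices of `D`. -/
def Connects (s t : β → α) (F : Set β) (D : Set α) : Prop :=
  ∀ x ∈ D, ∀ y ∈ D, EdgeJoined s t F x y

theorem linearIndepOn_single_sub_single (x : α) {D : Set α} (hx : x ∉ D) :
    LinearIndepOn ℚ (fun y => (Finsupp.single y 1 - Finsupp.single x 1 : α →₀ ℚ)) D := by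
  classical
  rw [linearIndepOn_iff']
  intro T g hT h0 y hy
  have := DFunLike.congr_fun h0 y
  have hxy : x ≠ y := fun h => hx (h ▸ hT hy)
  simpa [Finsupp.finsetSum_apply, Finsupp.single_apply, hxy, hy] using this

/-- The |D|-1 independent differences with a fixed vertex of `D` lie in the span of the |F| edge
vectors. -/
theorem Connects.card_le {F : Finset β} {D : Finset α} (h : Connects s t (F : Set β) D) :
    D.card ≤ F.card + 1 := by
  classical
  obtain rfl | ⟨x, hx⟩ := D.eq_empty_or_nonempty
  · simp
  have hind := linearIndepOn_single_sub_single x (D := (D.erase x : Finset α)) (by simp)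
  have h1 := hind.finrank_span_image_finset
  have h2 : Submodule.span ℚ ((fun y => (Finsupp.single y 1 - Finsupp.single x 1 : α →₀ ℚ)) ''
      (D.erase x : Finset α)) ≤ Submodule.span ℚ (edgeVec s t '' F) := by
    rw [Submodule.span_le]
    rintro _ ⟨y, hy, rfl⟩
    exact h y (Finset.mem_of_mem_erase hy) x hx
  have : FiniteDimensional ℚ (Submodule.span ℚ (edgeVec s t '' (F : Set β))) :=
    FiniteDimensional.span_of_finite ℚ (F.finite_toSet.image _)
  have h3 := Submodule.finrank_mono h2
  have h4 := finrank_span_image_finset_le (K := ℚ) (v := edgeVec s t) F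
  have := Finset.card_erase_add_one hx
  omega

theorem span_edgeVec_le {F : Set β} {D : Set α} (x : α)
    (hF : ∀ e ∈ F, s e ∈ D ∧ t e ∈ D) : Submodule.span ℚ (edgeVec s t '' F) ≤
      Submodule.span ℚ ((fun y => (Finsupp.single y 1 - Finsupp.single x 1 : α →₀ ℚ)) ''
        (D \ {x})) := by
  have key : ∀ y ∈ D, (Finsupp.single y 1 - Finsupp.single x 1 : α →₀ ℚ) ∈
      Submodule.span ℚ ((fun y => (Finsupp.single y 1 - Finsupp.single x 1 : α →₀ ℚ)) ''
        (D \ {x})) := by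
    intro y hy
    by_cases h : y = x
    · simp [h]
    · exact Submodule.subset_span ⟨y, ⟨hy, h⟩, rfl⟩
  rw [Submodule.span_le]
  rintro _ ⟨e, he, rfl⟩
  have := Submodule.sub_mem _ (key _ (hF e he).1) (key _ (hF e he).2)
  simpa [edgeVec] using this

theorem card_lt_of_linearIndepOn {F : Finset β} {D : Finset α} (hD : D.Nonempty)
    (hF : ∀ e ∈ F, s e ∈ D ∧ t e ∈ D) (hind : LinearIndepOn ℚ (edgeVec s t) (F : Set β)) :
    F.card + 1 ≤ D.card := by
  classical
  obtain ⟨x, hx⟩ := hD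
  have h1 := span_edgeVec_le (F := (F : Set β)) (D := (D : Set α)) x hF
  rw [← Finset.coe_singleton, ← Finset.coe_sdiff] at h1
  have : FiniteDimensional ℚ (Submodule.span ℚ ((fun y => (Finsupp.single y 1 -
      Finsupp.single x 1 : α →₀ ℚ)) '' ((D \ {x} : Finset α) : Set α))) :=
    FiniteDimensional.span_of_finite ℚ ((D \ {x}).finite_toSet.image _)
  have h2 := Submodule.finrank_mono h1
  rw [hind.finrank_span_image_finset] at h2
  have h3 := finrank_span_image_finset_le (K := ℚ)
    (v := fun y => (Finsupp.single y 1 - Finsupp.single x 1 : α →₀ ℚ)) (D \ {x})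
  rw [Finset.sdiff_singleton_eq_erase] at h2 h3
  have := Finset.card_erase_add_one hx
  omega

/-- The edge vectors lie in the span of the differences with a fixed vertex, of dimension |D|-1, and
are numerous enough to fill it. -/
theorem connects_of_linearIndepOn {F : Finset β} {D : Finset α}
    (hF : ∀ e ∈ F, s e ∈ D ∧ t e ∈ D) (hind : LinearIndepOn ℚ (edgeVec s t) (F : Set β))
    (hcard : F.card + 1 = D.card) : Connects s t (F : Set β) (D : Set α) := by
  classical
  obtain ⟨x, hx⟩ : D.Nonempty := Finset.card_pos.1 (by omega)
  have h1 := span_edgeVec_le (F := (F : Set β)) (D := (D : Set α)) x hF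
  rw [← Finset.coe_singleton, ← Finset.coe_sdiff] at h1
  have : FiniteDimensional ℚ (Submodule.span ℚ ((fun y => (Finsupp.single y 1 -
      Finsupp.single x 1 : α →₀ ℚ)) '' ((D \ {x} : Finset α) : Set α))) :=
    FiniteDimensional.span_of_finite ℚ ((D \ {x}).finite_toSet.image _)
  have h3 := (linearIndepOn_single_sub_single x
    (D := (D \ {x} : Finset α)) (by simp)).finrank_span_image_finset
  have h4 := Submodule.eq_of_le_of_finrank_eq h1 (by
    rw [hind.finrank_span_image_finset, h3, Finset.sdiff_singleton_eq_erase]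
    have := Finset.card_erase_add_one hx
    omega)
  have key : ∀ y ∈ (D : Set α), EdgeJoined s t F y x := by
    intro y hy
    by_cases h : y = x
    · subst h; exact .refl _ _
    · unfold EdgeJoined
      rw [h4]
      exact Submodule.subset_span ⟨y, by simpa [h] using hy, rfl⟩
  intro y hy z hz
  exact (key y hy).trans (key z hz).symm

end EdgeVectors

/-! ### Sparse edge sets and their decomposition into forests. -/

section NashWilliams

variable {α β : Type*} {s t : β → α} {m : ℕ}

open Classical in
/-- The edges in `F` with both ends in `W`. -/
noncomputable def edgesIn (s t : β → α) (F : Finset β) (W : Finset α) : Finset β :=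
  F.filter fun e => s e ∈ W ∧ t e ∈ W

@[simp]
theorem mem_edgesIn {F : Finset β} {W : Finset α} {e : β} :
    e ∈ edgesIn s t F W ↔ e ∈ F ∧ s e ∈ W ∧ t e ∈ W := by
  simp [edgesIn]

/-- Every nonempty vertex set `W` spans at most `m * (|W| - 1)` edges of `F`. -/
def IsSparse (s t : β → α) (m : ℕ) (F : Finset β) : Prop :=
  ∀ W : Finset α, W.Nonempty → (edgesIn s t F W).card + m ≤ m * W.card

theorem IsSparse.mono {F F' : Finset β} (h : IsSparse s t m F) (hF : F' ⊆ F) :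
    IsSparse s t m F' := by
  intro W hW
  refine le_trans (Nat.add_le_add_right (Finset.card_le_card ?_) _) (h W hW)
  intro e
  simp only [mem_edgesIn]
  exact fun ⟨h1, h2⟩ => ⟨hF h1, h2⟩

/-- Nash-Williams: a sparse edge set decomposes into `m` forests. -/
theorem IsSparse.exists_coloring (hm : 0 < m) {F : Finset β} (hF : IsSparse s t m F) :
    ∃ c : β → Fin m, ∀ i, LinearIndepOn ℚ (edgeVec s t) {f | f ∈ F ∧ c f = i} := by
  classical
  induction F using Finset.induction_on with
  | empty => exact ⟨fun _ => ⟨0, hm⟩, fun i => by simp⟩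
  | @insert e F he ih =>
    obtain ⟨c, hc⟩ := ih (hF.mono (Finset.subset_insert _ _))
    have hcls : ∀ i, colorClass (↑(insert e F) : Set β) e c i = {f | f ∈ F ∧ c f = i} := by
      intro i
      ext f
      simp only [colorClass, Finset.coe_insert, Set.mem_insert_iff, Set.mem_ofPred_eq,
        Finset.mem_coe]
      grind
    rcases exists_independent_coloring_or_obstruction (K := ℚ) (v := edgeVec s t)
      (F := (↑(insert e F) : Set β)) (e₀ := e) (c₀ := c) (by simp)
      (fun i => by rw [hcls]; exact hc i) with h | ⟨A, hAF, heA, hA⟩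
    · simpa using h
    exfalso
    have hsF : ∀ f ∈ A, f ∈ insert e F := fun f hf => hAF hf
    -- The component of `e` in the obstruction `A`. Each colour class connects it without using `e`,
    -- so together with `e` it spans more than m(|U|-1) edges.
    let U : Finset α :=
      ((insert e F).image s ∪ (insert e F).image t).filter fun y => EdgeJoined s t A (s e) y
    have hU : ∀ f ∈ A, s f ∈ U ↔ t f ∈ U := by
      intro f hf
      have hs : s f ∈ (insert e F).image s ∪ (insert e F).image t :=
        Finset.mem_union_left _ (Finset.mem_image_of_mem _ (hsF f hf))
      have ht : t f ∈ (insert e F).image s ∪ (insert e F).image t :=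
        Finset.mem_union_right _ (Finset.mem_image_of_mem _ (hsF f hf))
      simp only [U, Finset.mem_filter, hs, ht, true_and]
      exact ⟨fun h => h.trans (.of_mem hf), fun h => h.trans (EdgeJoined.of_mem hf).symm⟩
    have hse : s e ∈ U := by
      simp only [U, Finset.mem_filter, EdgeJoined.refl, and_true]
      exact Finset.mem_union_left _ (Finset.mem_image_of_mem _ (hsF e heA))
    have hte : t e ∈ U := (hU e heA).1 hse
    have hcon : ∀ i, U.card ≤ (((edgesIn s t (insert e F) U).erase e).filter
        fun f => c f = i).card + 1 := by
      intro i
      refine Connects.card_le (s := s) (t := t) ?_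
      have key : ∀ y ∈ (U : Set α), EdgeJoined s t (((edgesIn s t (insert e F) U).erase e).filter
          fun f => c f = i : Finset β) (s e) y := by
        intro y hy
        have hy' : EdgeJoined s t A (s e) y := (Finset.mem_filter.1 hy).2
        have h1 := hy'.of_forall (hA i)
        have h2 := h1.inter_of_closed (U := (U : Set α)) hse fun f hf => hU f hf.1
        refine h2.mono ?_
        rintro f ⟨⟨hfA, hf1, hf2, hf3⟩, hf4, hf5⟩
        simp only [Finset.coe_filter, Finset.mem_erase, mem_edgesIn, Set.mem_ofPred_eq]
        exact ⟨⟨hf2, hsF f hfA, hf4, hf5⟩, hf3⟩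
      exact fun y hy z hz => (key y hy).symm.trans (key z hz)
    have hsum := Finset.card_eq_sum_card_fiberwise (f := c)
      (s := (edgesIn s t (insert e F) U).erase e) (t := Finset.univ) (by simp)
    have hle : ∑ _i : Fin m, U.card ≤ ∑ i : Fin m,
      ((((edgesIn s t (insert e F) U).erase e).filter fun f => c f = i).card + 1) :=
      Finset.sum_le_sum fun i _ => hcon i
    rw [Finset.sum_add_distrib, ← hsum] at hle
    simp only [Finset.sum_const, Finset.card_univ, Fintype.card_fin, smul_eq_mul, mul_one] at hle
    have h1 := hF U ⟨_, hse⟩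
    have h2 := Finset.card_erase_add_one
      (s := edgesIn s t (insert e F) U) (a := e) (by simp [hse, hte])
    omega

/-- On a tight vertex set each forest of a decomposition is spanning. -/
theorem connects_of_tight {F : Finset β} {c : β → Fin m}
    (hc : ∀ i, LinearIndepOn ℚ (edgeVec s t) {f | f ∈ F ∧ c f = i}) {C : Finset α}
    (hCne : C.Nonempty) (hC : m * C.card ≤ (edgesIn s t F C).card + m) (i : Fin m) :
    Connects s t {f | f ∈ edgesIn s t F C ∧ c f = i} (C : Set α) := by
  classical
  have hcls : ∀ i, {f | f ∈ edgesIn s t F C ∧ c f = i} =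
      (((edgesIn s t F C).filter fun f => c f = i : Finset β) : Set β) := by
    intro i; ext f; simp
  have hind : ∀ i, LinearIndepOn ℚ (edgeVec s t)
      (((edgesIn s t F C).filter fun f => c f = i : Finset β) : Set β) := by
    intro i
    rw [← hcls]
    exact (hc i).mono fun f hf => ⟨(mem_edgesIn.1 hf.1).1, hf.2⟩
  have hin : ∀ i, ∀ e ∈ (edgesIn s t F C).filter (fun f => c f = i), s e ∈ C ∧ t e ∈ C :=
    fun i e he => (mem_edgesIn.1 (Finset.mem_filter.1 he).1).2
  have hle : ∀ i, ((edgesIn s t F C).filter fun f => c f = i).card + 1 ≤ C.card :=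
    fun i => card_lt_of_linearIndepOn hCne (hin i) (hind i)
  rw [hcls]
  -- No forest has more than |C|-1 edges in `C`, and the m forests have at least m(|C|-1) in total,
  -- so each attains the maximum.
  refine connects_of_linearIndepOn (hin i) (hind i) (le_antisymm (hle i) ?_)
  by_contra hlt
  push Not at hlt
  have hsum := Finset.card_eq_sum_card_fiberwise (f := c)
    (s := edgesIn s t F C) (t := Finset.univ) (by simp)
  have h2 : ∑ i : Fin m, (((edgesIn s t F C).filter fun f => c f = i).card + 1) <
      ∑ _i : Fin m, C.card :=
    Finset.sum_lt_sum (fun j _ => hle j) ⟨i, Finset.mem_univ _, hlt⟩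
  rw [Finset.sum_add_distrib, ← hsum] at h2
  simp only [Finset.sum_const, Finset.card_univ, Fintype.card_fin, smul_eq_mul, mul_one] at h2
  omega

end NashWilliams

/-! ### Tight sets, exchanges and degrees. -/

section Tight

variable {α β : Type*} {s t : β → α} {m : ℕ} {F F' : Finset β}

/-- A vertex set is tight if it spans exactly `m * (|W| - 1)` edges of `F`. -/
def IsTight (s t : β → α) (m : ℕ) (F : Finset β) (W : Finset α) : Prop :=
  W.Nonempty ∧ (edgesIn s t F W).card + m = m * W.card

theorem edgesIn_mono {A B : Finset α} (h : A ⊆ B) : edgesIn s t F A ⊆ edgesIn s t F B := by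
  intro e
  simp only [mem_edgesIn]
  exact fun ⟨h1, h2, h3⟩ => ⟨h1, h h2, h h3⟩

theorem IsTight.congr {C : Finset α} (hC : IsTight s t m F C)
    (h : ∀ e, s e ∈ C → t e ∈ C → (e ∈ F' ↔ e ∈ F)) : IsTight s t m F' C := by
  have heq : edgesIn s t F' C = edgesIn s t F C := by
    ext e
    simp only [mem_edgesIn]
    exact and_congr_left fun h' => h e h'.1 h'.2
  exact ⟨hC.1, heq ▸ hC.2⟩

theorem card_edgesIn_add_le [DecidableEq α] (F : Finset β) (A B : Finset α) :
    (edgesIn s t F A).card + (edgesIn s t F B).card ≤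
      (edgesIn s t F (A ∪ B)).card + (edgesIn s t F (A ∩ B)).card := by
  classical
  rw [← Finset.card_union_add_card_inter]
  refine Nat.add_le_add (Finset.card_le_card ?_) (Finset.card_le_card ?_)
  · exact Finset.union_subset (edgesIn_mono Finset.subset_union_left)
      (edgesIn_mono Finset.subset_union_right)
  · intro e
    simp only [Finset.mem_inter, mem_edgesIn]
    tauto

theorem mul_card_union_add_inter [DecidableEq α] (m : ℕ) (A B : Finset α) :
    m * (A ∪ B).card + m * (A ∩ B).card = m * A.card + m * B.card := by
  rw [← mul_add, Finset.card_union_add_card_inter, mul_add]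

/-- The number of spanned edges is supermodular and its upper bound modular, so equality for `A` and
`B` forces equality for union and intersection. -/
theorem IsTight.union_inter [DecidableEq α] (hF : IsSparse s t m F) {A B : Finset α}
    (hA : IsTight s t m F A) (hB : IsTight s t m F B) (hAB : (A ∩ B).Nonempty) :
    IsTight s t m F (A ∪ B) ∧ IsTight s t m F (A ∩ B) := by
  have h1 := card_edgesIn_add_le (s := s) (t := t) F A B
  have h2 := mul_card_union_add_inter m A B
  have h3 := hF (A ∪ B) (hA.1.mono Finset.subset_union_left)
  have h4 := hF (A ∩ B) hAB
  have h5 := hA.2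
  have h6 := hB.2
  exact ⟨⟨hA.1.mono Finset.subset_union_left, by omega⟩, hAB, by omega⟩

theorem IsTight.union [DecidableEq α] (hF : IsSparse s t m F) {A B : Finset α} {x : α}
    (hA : IsTight s t m F A) (hB : IsTight s t m F B) (hxA : x ∈ A) (hxB : x ∈ B) :
    IsTight s t m F (A ∪ B) :=
  (hA.union_inter hF hB ⟨x, Finset.mem_inter.2 ⟨hxA, hxB⟩⟩).1

theorem IsTight.inter [DecidableEq α] (hF : IsSparse s t m F) {A B : Finset α} {x : α}
    (hA : IsTight s t m F A) (hB : IsTight s t m F B) (hxA : x ∈ A) (hxB : x ∈ B) :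
    IsTight s t m F (A ∩ B) :=
  (hA.union_inter hF hB ⟨x, Finset.mem_inter.2 ⟨hxA, hxB⟩⟩).2

theorem isTight_singleton (hF : IsSparse s t m F) (v : α) : IsTight s t m F {v} := by
  have := hF {v} (Finset.singleton_nonempty v)
  simp only [Finset.card_singleton, mul_one] at this
  exact ⟨Finset.singleton_nonempty v, by simp only [Finset.card_singleton]; omega⟩

theorem IsTight.exists_least (hF : IsSparse s t m F) {Q : Finset α} {x y : α}
    (hQ : IsTight s t m F Q) (hx : x ∈ Q) (hy : y ∈ Q) :
    ∃ W, IsTight s t m F W ∧ x ∈ W ∧ y ∈ W ∧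
      ∀ Z, IsTight s t m F Z → x ∈ Z → y ∈ Z → W ⊆ Z := by
  classical
  obtain ⟨W, ⟨hW, hxW, hyW⟩, hmin⟩ := exists_minimal_of_wellFoundedLT
    (fun W => IsTight s t m F W ∧ x ∈ W ∧ y ∈ W) ⟨Q, hQ, hx, hy⟩
  refine ⟨W, hW, hxW, hyW, fun Z hZ hxZ hyZ => ?_⟩
  have := hmin (y := Z ∩ W) ⟨hZ.inter hF hW hxZ hxW, by simp [hxZ, hxW], by simp [hyZ, hyW]⟩
    Finset.inter_subset_right
  exact this.trans Finset.inter_subset_left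

/-- If `z` were isolated in `W`, the remaining vertices would span m more edges than sparsity
allows. -/
theorem IsTight.exists_edge_at (hm : 0 < m) (hF : IsSparse s t m F) {W : Finset α}
    (hW : IsTight s t m F W) {x z : α} (hx : x ∈ W) (hz : z ∈ W) (hxz : x ≠ z) :
    ∃ f ∈ edgesIn s t F W, s f = z ∨ t f = z := by
  classical
  by_contra! hno
  have hsub : edgesIn s t F W ⊆ edgesIn s t F (W.erase z) := by
    intro f hf
    have := hno f hf
    rw [mem_edgesIn] at hf
    simp [hf, this]
  have h1 := Finset.card_le_card hsub
  have h2 := hF (W.erase z) ⟨x, by simp [hx, hxz]⟩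
  have h3 := hW.2
  rw [← Finset.card_erase_add_one hz, mul_add] at h3
  omega

/-- Exchanging a new edge with an edge in the least tight set around it preserves sparsity. -/
theorem IsSparse.exchange [DecidableEq β] (hF : IsSparse s t m F) {e f : β} {W : Finset α}
    (hW : ∀ Z, IsTight s t m F Z → s e ∈ Z → t e ∈ Z → W ⊆ Z) (hf : f ∈ edgesIn s t F W) :
    IsSparse s t m (insert e (F.erase f)) := by
  intro Z hZ
  have hF' := hF Z hZ
  by_cases he : s e ∈ Z ∧ t e ∈ Z
  · have hsub : edgesIn s t (insert e (F.erase f)) Z ⊆ insert e ((edgesIn s t F Z).erase f) := by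
      intro g
      simp only [mem_edgesIn, Finset.mem_insert, Finset.mem_erase]
      tauto
    have h1 := (Finset.card_le_card hsub).trans (Finset.card_insert_le _ _)
    -- Either the loss of `f` pays for `e`, or `Z` does not contain `W`, is therefore not tight, and
    -- has room for one more edge.
    by_cases hfZ : f ∈ edgesIn s t F Z
    · have := Finset.card_erase_add_one hfZ
      omega
    · rw [Finset.erase_eq_of_notMem hfZ] at h1
      have hne : (edgesIn s t F Z).card + m ≠ m * Z.card := fun h =>
        hfZ (edgesIn_mono (hW Z ⟨hZ, h⟩ he.1 he.2) hf)
      omega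
  · refine le_trans (Nat.add_le_add_right (Finset.card_le_card ?_) _) hF'
    intro g
    simp only [mem_edgesIn, Finset.mem_insert, Finset.mem_erase]
    rintro ⟨rfl | h, hin⟩
    · exact absurd hin he
    · exact ⟨h.2, hin⟩

/-- The edges of `F'` inside `C` together with the edges of `F` not inside `C`. -/
noncomputable def swapInside (s t : β → α) (F F' : Finset β) (C : Finset α) : Finset β :=
  open Classical in (F \ edgesIn s t F C) ∪ edgesIn s t F' C

theorem mem_swapInside {C : Finset α} {e : β} : e ∈ swapInside s t F F' C ↔
    (s e ∈ C ∧ t e ∈ C ∧ e ∈ F') ∨ (¬ (s e ∈ C ∧ t e ∈ C) ∧ e ∈ F) := by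
  classical
  simp only [swapInside, Finset.mem_union, Finset.mem_sdiff, mem_edgesIn]
  tauto

theorem mem_swapInside_of_inside {C : Finset α} {e : β} (hs : s e ∈ C) (ht : t e ∈ C) :
    e ∈ swapInside s t F F' C ↔ e ∈ F' := by
  simp [mem_swapInside, hs, ht]

theorem mem_swapInside_of_not_inside {C : Finset α} {e : β} (h : ¬ (s e ∈ C ∧ t e ∈ C)) :
    e ∈ swapInside s t F F' C ↔ e ∈ F := by
  rw [mem_swapInside]
  tauto

theorem card_swapInside {C : Finset α}
    (h : (edgesIn s t F C).card = (edgesIn s t F' C).card) :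
    (swapInside s t F F' C).card = F.card := by
  classical
  have hdisj : Disjoint (F \ edgesIn s t F C) (edgesIn s t F' C) := by
    rw [Finset.disjoint_left]
    intro e
    simp only [Finset.mem_sdiff, mem_edgesIn]
    tauto
  have hsub : edgesIn s t F C ⊆ F := fun e he => (mem_edgesIn.1 he).1
  rw [swapInside, Finset.card_union_of_disjoint hdisj, ← h]
  exact Finset.card_sdiff_add_card_eq_card hsub

/-- By supermodularity and tightness of `C`, the edges of `F` in `W` but not inside `W ∩ C` number
at most m(|W ∪ C|-|C|); sparsity of `F'` on `W ∩ C` bounds the rest. -/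
theorem IsSparse.swapInside (hF : IsSparse s t m F) (hF' : IsSparse s t m F') {C : Finset α}
    (hC : IsTight s t m F C) : IsSparse s t m (swapInside s t F F' C) := by
  classical
  intro W hW
  by_cases hWC : (W ∩ C).Nonempty
  · have hsub : edgesIn s t (_root_.swapInside s t F F' C) W ⊆
        (edgesIn s t F W \ edgesIn s t F (W ∩ C)) ∪ edgesIn s t F' (W ∩ C) := by
      intro e
      simp only [mem_edgesIn, mem_swapInside, Finset.mem_union, Finset.mem_sdiff, Finset.mem_inter]
      tauto
    have h1 := (Finset.card_le_card hsub).trans (Finset.card_union_le _ _)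
    have h2 := Finset.card_sdiff_add_card_eq_card
      (edgesIn_mono (s := s) (t := t) (F := F) (Finset.inter_subset_left (s₁ := W) (s₂ := C)))
    have h3 := hF' (W ∩ C) hWC
    have h4 := hF (W ∪ C) (hW.mono Finset.subset_union_left)
    have h5 := hC.2
    have h6 := card_edgesIn_add_le (s := s) (t := t) F W C
    have h7 := mul_card_union_add_inter m W C
    omega
  · refine le_trans (Nat.add_le_add_right (Finset.card_le_card ?_) _) (hF W hW)
    intro e
    simp only [mem_edgesIn, mem_swapInside]
    rintro ⟨⟨h1, -⟩ | h, h2, h3⟩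
    · exact absurd ⟨s e, Finset.mem_inter.2 ⟨h2, h1⟩⟩ hWC
    · exact ⟨h.2, h2, h3⟩

/-- `F` and `F'` have the same edges not inside `C`. -/
def AgreeOff (s t : β → α) (C : Finset α) (F' F : Finset β) : Prop :=
  ∀ e, ¬ (s e ∈ C ∧ t e ∈ C) → (e ∈ F' ↔ e ∈ F)

theorem AgreeOff.card_edgesIn_eq {C : Finset α} (h : AgreeOff s t C F' F)
    (hcard : F'.card = F.card) : (edgesIn s t F' C).card = (edgesIn s t F C).card := by
  classical
  have h1 : F' \ edgesIn s t F' C = F \ edgesIn s t F C := by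
    ext e
    simp only [Finset.mem_sdiff, mem_edgesIn]
    have := h e
    tauto
  have h2 := Finset.card_sdiff_add_card_eq_card
    (show edgesIn s t F' C ⊆ F' from fun e he => (mem_edgesIn.1 he).1)
  have h3 := Finset.card_sdiff_add_card_eq_card
    (show edgesIn s t F C ⊆ F from fun e he => (mem_edgesIn.1 he).1)
  rw [h1] at h2
  omega

theorem AgreeOff.isTight_iff {C : Finset α} (h : AgreeOff s t C F' F)
    (hcard : F'.card = F.card) : IsTight s t m F' C ↔ IsTight s t m F C := by
  rw [IsTight, IsTight, h.card_edgesIn_eq hcard]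

open Classical in
/-- The number of edges of `F` incident with `v`. -/
noncomputable def edgeDegree (s t : β → α) (F : Finset β) (v : α) : ℕ :=
  (F.filter fun e => s e = v ∨ t e = v).card

theorem edgeDegree_congr {v : α} (h : ∀ e, s e = v ∨ t e = v → (e ∈ F' ↔ e ∈ F)) :
    edgeDegree s t F' v = edgeDegree s t F v := by
  classical
  unfold edgeDegree
  congr 1
  ext e
  simp only [Finset.mem_filter]
  have := h e
  tauto

theorem AgreeOff.edgeDegree_eq {C : Finset α} (h : AgreeOff s t C F' F) {v : α} (hv : v ∉ C) :
    edgeDegree s t F' v = edgeDegree s t F v := by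
  refine edgeDegree_congr fun e he => h e fun hC => hv ?_
  rcases he with rfl | rfl
  exacts [hC.1, hC.2]

theorem edgeDegree_mono (h : F' ⊆ F) (v : α) : edgeDegree s t F' v ≤ edgeDegree s t F v := by
  classical
  exact Finset.card_le_card (Finset.filter_subset_filter _ h)

theorem edgeDegree_insert_le [DecidableEq β] (F : Finset β) (e : β) (v : α) :
    edgeDegree s t (insert e F) v ≤ edgeDegree s t F v + 1 := by
  classical
  unfold edgeDegree
  rw [Finset.filter_insert]
  split_ifs
  · exact Finset.card_insert_le _ _
  · exact Nat.le_succ _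

theorem edgeDegree_insert_of_ne [DecidableEq β] (F : Finset β) {e : β} {v : α} (hs : s e ≠ v)
    (ht : t e ≠ v) : edgeDegree s t (insert e F) v = edgeDegree s t F v := by
  classical
  unfold edgeDegree
  rw [Finset.filter_insert, if_neg (by simp [hs, ht])]

theorem edgeDegree_erase_add_one [DecidableEq β] {f : β} {v : α} (hf : f ∈ F)
    (hv : s f = v ∨ t f = v) : edgeDegree s t (F.erase f) v + 1 = edgeDegree s t F v := by
  classical
  unfold edgeDegree
  rw [Finset.filter_erase, Finset.card_erase_add_one]
  simp [hf, hv]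

end Tight

/-! ### Rearrangements of an optimal base and the saturated set. -/

section Saturation

variable {α β : Type*} {s t : β → α} {m : ℕ} {V : Finset α} {E H H' : Finset β} {h : α → ℕ}

/-- `H` is a set of `m * (|V| - 1)` edges in `E` that is sparse; such sets are the unions of `m`
edge-disjoint spanning trees. -/
structure IsTreeBase (s t : β → α) (m : ℕ) (V : Finset α) (E H : Finset β) : Prop where
  subset : H ⊆ E
  sparse : IsSparse s t m H
  card_eq : H.card + m = m * V.card

theorem IsTreeBase.card_eq_card (hH : IsTreeBase s t m V E H) (hH' : IsTreeBase s t m V E H') :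
    H'.card = H.card := by
  have := hH.card_eq
  have := hH'.card_eq
  omega

theorem IsTreeBase.isTight (hH : IsTreeBase s t m V E H) (hV : V.Nonempty)
    (hE : ∀ e ∈ E, s e ∈ V ∧ t e ∈ V) : IsTight s t m H V := by
  refine ⟨hV, ?_⟩
  rw [← hH.card_eq]
  congr 2
  ext e
  rw [mem_edgesIn]
  exact ⟨fun h => h.1, fun h => ⟨h, hE e (hH.subset h)⟩⟩

/-- Tightness does not refer to `V`. But `C ∪ V` is tight as well, and `H` has only enough edges for
|V| vertices. -/
theorem IsTreeBase.subset_of_isTight (hm : 0 < m) (hH : IsTreeBase s t m V E H)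
    (hE : ∀ e ∈ E, s e ∈ V ∧ t e ∈ V) {C : Finset α} {x : α} (hC : IsTight s t m H C)
    (hxC : x ∈ C) (hxV : x ∈ V) : C ⊆ V := by
  classical
  have h1 := (hC.union hH.sparse (hH.isTight ⟨x, hxV⟩ hE) hxC hxV).2
  have h2 : (edgesIn s t H (C ∪ V)).card ≤ H.card :=
    Finset.card_le_card fun e he => (mem_edgesIn.1 he).1
  have h3 := hH.card_eq
  have h4 : m * (C ∪ V).card ≤ m * V.card := by omega
  have h5 := Finset.eq_of_subset_of_card_le (Finset.subset_union_right (s₁ := C) (s₂ := V))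
    (Nat.le_of_mul_le_mul_left h4 hm)
  rw [h5]
  exact Finset.subset_union_left

/-- No degree of `H'` exceeds both the bound `h` and the degree in `H`. -/
def DegreeDominated (s t : β → α) (h : α → ℕ) (H' H : Finset β) : Prop :=
  ∀ v, edgeDegree s t H' v ≤ max (h v) (edgeDegree s t H v)

/-- `K` is a rearrangement of the base `H` inside a tight set `C` containing `v` and avoiding
`U`, without new violations of the degree bounds. -/
structure IsRearrangement (s t : β → α) (m : ℕ) (V : Finset α) (E H : Finset β) (h : α → ℕ)
    (U : Finset α) (v : α) (C : Finset α) (K : Finset β) : Prop where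
  tight : IsTight s t m H C
  mem : v ∈ C
  disjoint : Disjoint C U
  base : IsTreeBase s t m V E K
  agree : AgreeOff s t C K H
  dominated : DegreeDominated s t h K H

/-- If the ends of an edge `e ∉ H` lie in different components, both of which have a
rearrangement leaving room for `e`, then `e` can be inserted at the expense of an edge at some
vertex `z ∈ U' \ U`. -/
theorem exists_rearrangement_of_crossing (hm : 0 < m) (hH : IsTreeBase s t m V E H)
    {U U' : Finset α} (hUU' : U ⊆ U') {e : β} (heE : e ∈ E) (heH : e ∉ H)
    {Q C₁ C₂ : Finset α} {H₁ H₂ : Finset β}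
    (hQ : IsTight s t m H Q) (hsQ : s e ∈ Q) (htQ : t e ∈ Q) (hQU : Disjoint Q U)
    (h₁ : IsRearrangement s t m V E H h U' (s e) C₁ H₁) (hd₁ : edgeDegree s t H₁ (s e) < h (s e))
    (h₂ : IsRearrangement s t m V E H h U' (t e) C₂ H₂) (hd₂ : edgeDegree s t H₂ (t e) < h (t e))
    (hno : ∀ C, IsTight s t m H C → Disjoint C U' → s e ∈ C → t e ∉ C) :
    ∃ z ∈ U', z ∉ U ∧ ∃ Q' H', IsRearrangement s t m V E H h U z Q' H' ∧
      edgeDegree s t H' z + 1 = edgeDegree s t H z := by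
  classical
  -- If they met, their union would be a tight set avoiding `U'` with both ends of `e`.
  have hC₁₂ : Disjoint C₁ C₂ := by
    rw [Finset.disjoint_left]
    intro x hx₁ hx₂
    exact hno _ (h₁.tight.union hH.sparse h₂.tight hx₁ hx₂)
      (Finset.disjoint_union_left.2 ⟨h₁.disjoint, h₂.disjoint⟩)
      (Finset.mem_union_left _ h₁.mem) (Finset.mem_union_right _ h₂.mem)
  have hdisj : ∀ x, x ∈ C₁ → x ∉ C₂ := fun x hx => Finset.disjoint_left.1 hC₁₂ hx
  have hC₂H₁ : IsTight s t m H₁ C₂ :=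
    h₂.tight.congr fun f hs _ => h₁.agree f fun h' => hdisj _ h'.1 hs
  have hC₂H₂ : IsTight s t m H₂ C₂ :=
    (h₂.agree.isTight_iff (hH.card_eq_card h₂.base)).2 h₂.tight
  -- `J` performs both rearrangements at once: `H₁` inside `C₁`, `H₂` inside `C₂`, `H` elsewhere.
  -- Both ends of `e` then have room for it.
  obtain ⟨J, hJdef⟩ : ∃ J, J = swapInside s t H₁ H₂ C₂ := ⟨_, rfl⟩
  have hJon : ∀ f, s f ∈ C₂ → t f ∈ C₂ → (f ∈ J ↔ f ∈ H₂) := fun f hs ht => by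
    rw [hJdef, mem_swapInside_of_inside hs ht]
  have hJoff : ∀ f, ¬ (s f ∈ C₂ ∧ t f ∈ C₂) → (f ∈ J ↔ f ∈ H₁) := fun f hf => by
    rw [hJdef, mem_swapInside_of_not_inside hf]
  have hJcard : J.card = H.card := by
    rw [hJdef, card_swapInside, hH.card_eq_card h₁.base]
    have := hC₂H₁.2
    have := hC₂H₂.2
    omega
  have hJsparse : IsSparse s t m J := hJdef ▸ h₁.base.sparse.swapInside h₂.base.sparse hC₂H₁
  have hJE : J ⊆ E := by
    intro f hf
    by_cases hin : s f ∈ C₂ ∧ t f ∈ C₂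
    exacts [h₂.base.subset ((hJon f hin.1 hin.2).1 hf), h₁.base.subset ((hJoff f hin).1 hf)]
  have hJagree : ∀ Z : Finset α, C₁ ⊆ Z → C₂ ⊆ Z → AgreeOff s t Z J H := fun Z hZ₁ hZ₂ f hf =>
    (hJoff f fun h' => hf ⟨hZ₂ h'.1, hZ₂ h'.2⟩).trans
      (h₁.agree f fun h' => hf ⟨hZ₁ h'.1, hZ₁ h'.2⟩)
  have hdeg₁ : ∀ v, v ∉ C₂ → edgeDegree s t J v = edgeDegree s t H₁ v := by
    intro v hv
    refine edgeDegree_congr fun f hf => hJoff f ?_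
    rintro ⟨ha, hb⟩
    rcases hf with rfl | rfl
    exacts [hv ha, hv hb]
  have hdeg₂ : ∀ v ∈ C₂, edgeDegree s t J v = edgeDegree s t H₂ v := by
    intro v hv
    refine edgeDegree_congr fun f hf => ?_
    by_cases hin : s f ∈ C₂ ∧ t f ∈ C₂
    · exact hJon f hin.1 hin.2
    rw [hJoff f hin, h₂.agree f hin]
    refine h₁.agree f ?_
    rintro ⟨ha, hb⟩
    rcases hf with rfl | rfl
    exacts [hdisj _ ha hv, hdisj _ hb hv]
  have hdeg₀ : ∀ v, v ∉ C₁ → v ∉ C₂ → edgeDegree s t J v = edgeDegree s t H v := by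
    intro v hv₁ hv₂
    rw [hdeg₁ v hv₂, h₁.agree.edgeDegree_eq hv₁]
  have htC₁ : t e ∉ C₁ := hno _ h₁.tight h₁.disjoint h₁.mem
  have hsC₂ : s e ∉ C₂ := hdisj _ h₁.mem
  have heJ : e ∉ J := by
    rw [hJoff e fun h' => hsC₂ h'.1, h₁.agree e fun h' => htC₁ h'.2]
    exact heH
  have hQ₁ := hQ.union hH.sparse h₁.tight hsQ h₁.mem
  have hQ' := hQ₁.union hH.sparse h₂.tight (Finset.mem_union_left _ htQ) h₂.mem
  set Q' := Q ∪ C₁ ∪ C₂ with hQ'def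
  have hC₁Q' : C₁ ⊆ Q' := by
    intro x hx; simp [hQ'def, hx]
  have hC₂Q' : C₂ ⊆ Q' := Finset.subset_union_right
  have hQQ' : Q ⊆ Q' := by
    intro x hx; simp [hQ'def, hx]
  have hQ'U : Disjoint Q' U := by
    rw [hQ'def, Finset.disjoint_union_left, Finset.disjoint_union_left]
    exact ⟨⟨hQU, h₁.disjoint.mono_right hUU'⟩, h₂.disjoint.mono_right hUU'⟩
  have hQ'J : IsTight s t m J Q' := ((hJagree Q' hC₁Q' hC₂Q').isTight_iff hJcard).2 hQ'
  obtain ⟨W, hW, hsW, htW, hWmin⟩ := hQ'J.exists_least hJsparse (hQQ' hsQ) (hQQ' htQ)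
  have hWQ' : W ⊆ Q' := hWmin _ hQ'J (hQQ' hsQ) (hQQ' htQ)
  -- If `W` avoided `U'`, so would `W ∪ C₁ ∪ C₂`. It is tight in `J`, hence in `H`, since the two
  -- agree off it, contrary to `hno`.
  obtain ⟨z, hzW, hzU'⟩ : ∃ z ∈ W, z ∈ U' := by
    by_contra! hWU'
    have hC₁J : IsTight s t m J (W ∪ C₁ ∪ C₂) := by
      have hC₁J' : IsTight s t m J C₁ :=
        ((h₁.agree.isTight_iff (hH.card_eq_card h₁.base)).2 h₁.tight).congr
          fun f hs _ => hJoff f fun h' => hdisj _ hs h'.1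
      have hC₂J : IsTight s t m J C₂ := hC₂H₂.congr hJon
      exact (hW.union hJsparse hC₁J' hsW h₁.mem).union hJsparse hC₂J
        (Finset.mem_union_left _ htW) h₂.mem
    have hC₁H : IsTight s t m H (W ∪ C₁ ∪ C₂) :=
      ((hJagree _ (by intro x hx; simp [hx]) Finset.subset_union_right).isTight_iff hJcard).1 hC₁J
    refine hno _ hC₁H ?_ (by simp [hsW]) (by simp [htW])
    rw [Finset.disjoint_union_left, Finset.disjoint_union_left]
    exact ⟨⟨Finset.disjoint_left.2 hWU', h₁.disjoint⟩, h₂.disjoint⟩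
  have hzC₁ : z ∉ C₁ := fun hz => Finset.disjoint_left.1 h₁.disjoint hz hzU'
  have hzC₂ : z ∉ C₂ := fun hz => Finset.disjoint_left.1 h₂.disjoint hz hzU'
  have hsz : s e ≠ z := fun hz => hzC₁ (hz ▸ h₁.mem)
  have htz : t e ≠ z := fun hz => hzC₂ (hz ▸ h₂.mem)
  have hzU : z ∉ U := Finset.disjoint_left.1 hQ'U (hWQ' hzW)
  obtain ⟨f, hfW, hfz⟩ := hW.exists_edge_at hm hJsparse hsW hzW hsz
  have hfJ : f ∈ J := (mem_edgesIn.1 hfW).1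
  refine ⟨z, hzU', hzU, Q', insert e (J.erase f), ⟨hQ', hWQ' hzW, hQ'U, ⟨?_, ?_, ?_⟩, ?_, ?_⟩, ?_⟩
  · exact Finset.insert_subset heE ((Finset.erase_subset _ _).trans hJE)
  · exact hJsparse.exchange hWmin hfW
  · rw [Finset.card_insert_of_notMem (fun h => heJ (Finset.mem_of_mem_erase h)),
      Finset.card_erase_add_one hfJ, hJcard, hH.card_eq]
  · intro g hg
    rw [← hJagree Q' hC₁Q' hC₂Q' g hg]
    have hge : g ≠ e := by
      rintro rfl
      exact hg ⟨hQQ' hsQ, hQQ' htQ⟩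
    have hgf : g ≠ f := by
      rintro rfl
      have := (mem_edgesIn.1 hfW).2
      exact hg ⟨hWQ' this.1, hWQ' this.2⟩
    simp [hge, hgf]
  · intro v
    have hmono : edgeDegree s t (J.erase f) v ≤ edgeDegree s t J v :=
      edgeDegree_mono (Finset.erase_subset _ _) v
    have hins := edgeDegree_insert_le (s := s) (t := t) (J.erase f) e v
    by_cases hv₁ : v = s e
    · subst hv₁
      rw [hdeg₁ _ hsC₂] at hmono
      exact le_trans (by omega) (le_max_left _ _)
    by_cases hv₂ : v = t e
    · subst hv₂
      rw [hdeg₂ _ h₂.mem] at hmono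
      exact le_trans (by omega) (le_max_left _ _)
    rw [edgeDegree_insert_of_ne _ (Ne.symm hv₁) (Ne.symm hv₂)]
    refine hmono.trans ?_
    by_cases hv : v ∈ C₂
    · rw [hdeg₂ v hv]; exact h₂.dominated v
    · rw [hdeg₁ v hv]; exact h₁.dominated v
  · rw [edgeDegree_insert_of_ne _ hsz htz, edgeDegree_erase_add_one hfJ hfz, hdeg₀ z hzC₁ hzC₂]

open Classical in
/-- The increasing sequence of vertex sets whose degrees cannot be lowered: first the vertices
violating the bound, then those which no rearrangement avoiding the previous set brings below it. -/
noncomputable def saturation (s t : β → α) (m : ℕ) (V : Finset α) (E H : Finset β) (h : α → ℕ) :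
    ℕ → Finset α
  | 0 => V.filter fun v => h v < edgeDegree s t H v
  | n + 1 => saturation s t m V E H h n ∪ V.filter fun v =>
      ∀ C H', IsRearrangement s t m V E H h (saturation s t m V E H h n) v C H' →
        h v ≤ edgeDegree s t H' v

theorem saturation_subset_succ (n : ℕ) :
    saturation s t m V E H h n ⊆ saturation s t m V E H h (n + 1) := by
  classical
  rw [saturation]
  exact Finset.subset_union_left

theorem saturation_zero_subset (n : ℕ) :
    saturation s t m V E H h 0 ⊆ saturation s t m V E H h n := by
  induction n with
  | zero => exact subset_rfl
  | succ n ih => exact ih.trans (saturation_subset_succ n)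

theorem saturation_subset (n : ℕ) : saturation s t m V E H h n ⊆ V := by
  classical
  induction n with
  | zero => exact Finset.filter_subset _ _
  | succ n ih => exact Finset.union_subset ih (Finset.filter_subset _ _)

theorem le_edgeDegree_of_mem_saturation (hH : IsTreeBase s t m V E H) (n : ℕ) {v : α}
    (hv : v ∈ saturation s t m V E H h n) : h v ≤ edgeDegree s t H v := by
  classical
  induction n with
  | zero => exact (Finset.mem_filter.1 hv).2.le
  | succ n ih =>
    by_cases hvn : v ∈ saturation s t m V E H h n
    · exact ih hvn
    rw [saturation, Finset.mem_union, Finset.mem_filter] at hv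
    refine (hv.resolve_left hvn).2 {v} H ⟨isTight_singleton hH.sparse v,
      Finset.mem_singleton_self v, ?_, hH, fun _ _ => Iff.rfl, fun _ => le_max_right _ _⟩
    exact Finset.disjoint_singleton_left.2 hvn

theorem exists_rearrangement_of_notMem_saturation {n : ℕ} {v : α} (hvV : v ∈ V)
    (hv : v ∉ saturation s t m V E H h (n + 1)) :
    ∃ C H', IsRearrangement s t m V E H h (saturation s t m V E H h n) v C H' ∧
      edgeDegree s t H' v < h v := by
  classical
  rw [saturation, Finset.mem_union, Finset.mem_filter] at hv
  push Not at hv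
  exact hv.2 hvV

/-- The total excess of the degrees over the bound. -/
noncomputable def totalExcess (s t : β → α) (V : Finset α) (h : α → ℕ) (H : Finset β) : ℕ :=
  ∑ v ∈ V, (edgeDegree s t H v - h v)

theorem DegreeDominated.totalExcess_lt (hdom : DegreeDominated s t h H' H) {z : α} (hz : z ∈ V)
    (hlt : h z < edgeDegree s t H z) (hz' : edgeDegree s t H' z < edgeDegree s t H z) :
    totalExcess s t V h H' < totalExcess s t V h H := by
  refine Finset.sum_lt_sum (fun v _ => ?_) ⟨z, hz, by omega⟩
  have := hdom v
  omega

/-- Failure yields a vertex `z` whose degree can be lowered by one. At stage zero `z` violates its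
bound, so the total excess drops; later `z` is newly saturated and, not being a violator, has degree
at most `h z`, so lowering it contradicts saturation. -/
theorem exists_tight_of_notMem_saturation (hm : 0 < m) (hH : IsTreeBase s t m V E H)
    (hE : ∀ e ∈ E, s e ∈ V ∧ t e ∈ V)
    (hmin : ∀ H', IsTreeBase s t m V E H' → totalExcess s t V h H ≤ totalExcess s t V h H')
    (n : ℕ) {e : β} (heE : e ∈ E) (heH : e ∉ H)
    (hs : s e ∉ saturation s t m V E H h (n + 1)) (ht : t e ∉ saturation s t m V E H h (n + 1)) :
    ∃ C, IsTight s t m H C ∧ Disjoint C (saturation s t m V E H h n) ∧ s e ∈ C ∧ t e ∈ C := by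
  classical
  induction n with
  | zero =>
    by_contra! hno
    obtain ⟨C₁, H₁, h₁, hd₁⟩ := exists_rearrangement_of_notMem_saturation (hE e heE).1 hs
    obtain ⟨C₂, H₂, h₂, hd₂⟩ := exists_rearrangement_of_notMem_saturation (hE e heE).2 ht
    obtain ⟨z, hz, -, Q', H', hr, hd⟩ := exists_rearrangement_of_crossing hm hH
      (Finset.empty_subset _) heE heH (hH.isTight ⟨_, (hE e heE).1⟩ hE) (hE e heE).1 (hE e heE).2
      (Finset.disjoint_empty_right _) h₁ hd₁ h₂ hd₂ hno
    rw [saturation, Finset.mem_filter] at hz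
    have := hr.dominated.totalExcess_lt hz.1 hz.2 (by omega)
    have := hmin H' hr.base
    omega
  | succ n ih =>
    by_contra! hno
    obtain ⟨Q, hQ, hQU, hsQ, htQ⟩ := ih (fun h => hs (saturation_subset_succ _ h))
      (fun h => ht (saturation_subset_succ _ h))
    obtain ⟨C₁, H₁, h₁, hd₁⟩ := exists_rearrangement_of_notMem_saturation (hE e heE).1 hs
    obtain ⟨C₂, H₂, h₂, hd₂⟩ := exists_rearrangement_of_notMem_saturation (hE e heE).2 ht
    obtain ⟨z, hz, hzU, Q', H', hr, hd⟩ := exists_rearrangement_of_crossing hm hH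
      (saturation_subset_succ n) heE heH hQ hsQ htQ hQU h₁ hd₁ h₂ hd₂ hno
    have hzV : z ∈ V := saturation_subset _ hz
    rw [saturation, Finset.mem_union, Finset.mem_filter] at hz
    have h3 := (hz.resolve_left hzU).2 Q' H' hr
    have h4 : z ∉ saturation s t m V E H h 0 := fun h => hzU (saturation_zero_subset n h)
    rw [saturation, Finset.mem_filter] at h4
    have h5 : edgeDegree s t H z ≤ h z := not_lt.1 fun h => h4 ⟨hzV, h⟩
    omega

/-- A base of least total excess has a set `S` containing every vertex that violates its bound,
consisting of vertices that attain their bound, such that every edge outside the base that avoids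
`S` lies in a tight set avoiding `S`. -/
theorem exists_saturated_set (hm : 0 < m) (hH : IsTreeBase s t m V E H)
    (hE : ∀ e ∈ E, s e ∈ V ∧ t e ∈ V)
    (hmin : ∀ H', IsTreeBase s t m V E H' → totalExcess s t V h H ≤ totalExcess s t V h H') :
    ∃ S ⊆ V, (∀ v ∈ V, h v < edgeDegree s t H v → v ∈ S) ∧ (∀ v ∈ S, h v ≤ edgeDegree s t H v) ∧
      ∀ e ∈ E, e ∉ H → s e ∉ S → t e ∉ S →
        ∃ C ⊆ V, IsTight s t m H C ∧ Disjoint C S ∧ s e ∈ C ∧ t e ∈ C := by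
  classical
  -- An increasing chain of subsets of the finite set `V` has two equal consecutive terms, which
  -- removes the index shift in the covering statement.
  obtain ⟨n, hn⟩ : ∃ n, saturation s t m V E H h (n + 1) = saturation s t m V E H h n := by
    by_contra! hne
    have hgrow : ∀ n, n ≤ (saturation s t m V E H h n).card := by
      intro n
      induction n with
      | zero => exact Nat.zero_le _
      | succ n ih =>
        have := Finset.card_lt_card
          ((saturation_subset_succ n).ssubset_of_ne (hne n).symm)
        omega
    have h1 := hgrow (V.card + 1)
    have h2 := Finset.card_le_card
      (saturation_subset (s := s) (t := t) (m := m) (V := V) (E := E) (H := H) (h := h) (V.card + 1))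
    omega
  refine ⟨saturation s t m V E H h n, saturation_subset n, fun v hv hlt => ?_,
    fun v hv => le_edgeDegree_of_mem_saturation hH n hv, fun e heE heH hs ht => ?_⟩
  · exact saturation_zero_subset n (by rw [saturation]; exact Finset.mem_filter.2 ⟨hv, hlt⟩)
  · obtain ⟨C, hC, hCS, hsC, htC⟩ := exists_tight_of_notMem_saturation hm hH hE hmin n heE heH
      (by rwa [hn]) (by rwa [hn])
    exact ⟨C, hH.subset_of_isTight hm hE hC hsC (hE e heE).1, hC, hCS, hsC, htC⟩

end Saturation

/-! ### Packings of connecting edge sets, and edge counts. -/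

section Packing

variable {α β : Type*} {s t : β → α} {m : ℕ}

/-- `D` is nonempty and its vertices are connected by each of `m` disjoint sets of edges of `E`
inside `D`. -/
def IsTreePacked (s t : β → α) (m : ℕ) (E : Set β) (D : Set α) : Prop :=
  D.Nonempty ∧ ∃ T : Fin m → Set β, (∀ i, ∀ e ∈ T i, e ∈ E ∧ s e ∈ D ∧ t e ∈ D) ∧
    (∀ i j, i ≠ j → Disjoint (T i) (T j)) ∧ ∀ i, Connects s t (T i) D

theorem Connects.exists_independent_subset {T : Set β} {D : Set α} (h : Connects s t T D) :
    ∃ B ⊆ T, LinearIndepOn ℚ (edgeVec s t) B ∧ Connects s t B D := by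
  obtain ⟨B, hBT, -, hspan, hind⟩ := exists_linearIndepOn_extension
    (K := ℚ) (v := edgeVec s t) (linearIndepOn_empty ℚ _) (Set.empty_subset T)
  exact ⟨B, hBT, hind, fun x hx y hy =>
    (h x hx y hy).of_forall fun e he => hspan ⟨e, he, rfl⟩⟩

theorem isTreePacked_singleton (E : Set β) (v : α) : IsTreePacked s t m E {v} := by
  refine ⟨Set.singleton_nonempty v, fun _ => ∅, by simp, by simp, ?_⟩
  rintro i x rfl y rfl
  exact .refl _ _

/-- Edges of the second packing inside `C` can be dropped, because each set of the first already
connects their ends; this restores disjointness. -/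
theorem IsTreePacked.union {E : Set β} {C D : Set α} {x : α} (hC : IsTreePacked s t m E C)
    (hD : IsTreePacked s t m E D) (hxC : x ∈ C) (hxD : x ∈ D) :
    IsTreePacked s t m E (C ∪ D) := by
  obtain ⟨hCne, T, hT, hTd, hTc⟩ := hC
  obtain ⟨-, T', hT', hTd', hTc'⟩ := hD
  refine ⟨hCne.mono Set.subset_union_left,
    fun i => T i ∪ (T' i \ {e | s e ∈ C ∧ t e ∈ C}), ?_, ?_, ?_⟩
  · rintro i e (he | he)
    · exact ⟨(hT i e he).1, Or.inl (hT i e he).2.1, Or.inl (hT i e he).2.2⟩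
    · exact ⟨(hT' i e he.1).1, Or.inr (hT' i e he.1).2.1, Or.inr (hT' i e he.1).2.2⟩
  · intro i j hij
    rw [Set.disjoint_left]
    rintro e (he | he) (he' | he')
    · exact Set.disjoint_left.1 (hTd i j hij) he he'
    · exact he'.2 (hT i e he).2
    · exact he.2 (hT j e he').2
    · exact Set.disjoint_left.1 (hTd' i j hij) he.1 he'.1
  · intro i
    have key : ∀ y ∈ C ∪ D,
        EdgeJoined s t (T i ∪ (T' i \ {e | s e ∈ C ∧ t e ∈ C})) x y := by
      rintro y (hy | hy)
      · exact (hTc i x hxC y hy).mono Set.subset_union_left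
      · refine (hTc' i x hxD y hy).of_forall fun e he => ?_
        by_cases heC : s e ∈ C ∧ t e ∈ C
        · exact (hTc i _ heC.1 _ heC.2).mono Set.subset_union_left
        · exact .of_mem (Or.inr ⟨he, heC⟩)
    exact fun y hy z hz => (key y hy).symm.trans (key z hz)

theorem IsTight.isTreePacked (hm : 0 < m) {H : Finset β} {E : Set β} (hH : IsSparse s t m H)
    (hHE : (H : Set β) ⊆ E) {C : Finset α} (hC : IsTight s t m H C) :
    IsTreePacked s t m E (C : Set α) := by
  obtain ⟨c, hc⟩ := hH.exists_coloring hm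
  refine ⟨hC.1, fun i => {f | f ∈ edgesIn s t H C ∧ c f = i}, ?_, ?_,
    fun i => connects_of_tight hc hC.1 hC.2.ge i⟩
  · rintro i e ⟨he, -⟩
    rw [mem_edgesIn] at he
    exact ⟨hHE he.1, he.2⟩
  · intro i j hij
    rw [Set.disjoint_left]
    rintro e ⟨-, he⟩ ⟨-, he'⟩
    exact hij (he.symm.trans he')

/-- Each connecting set is thinned to an independent one, with exactly |V|-1 edges; the union is
sparse since each of the m forests is. -/
theorem IsTreePacked.exists_isTreeBase {V : Finset α} {E : Finset β}
    (h : IsTreePacked s t m (E : Set β) (V : Set α)) :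
    ∃ H, IsTreeBase s t m V E H := by
  classical
  obtain ⟨hV, T, hT, hTd, hTc⟩ := h
  choose B hBT hBind hBc using fun i => (hTc i).exists_independent_subset
  let B' : Fin m → Finset β := fun i => E.filter fun e => e ∈ B i
  have hB' : ∀ i, (B' i : Set β) = B i := by
    intro i
    ext e
    simp only [B', Finset.coe_filter, Set.mem_ofPred_eq]
    exact ⟨fun h => h.2, fun h => ⟨(hT i e (hBT i h)).1, h⟩⟩
  have hmem : ∀ i e, e ∈ B' i ↔ e ∈ B i := fun i e => by rw [← hB' i, Finset.mem_coe]
  have hdisj : ∀ i j, i ≠ j → Disjoint (B' i) (B' j) := by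
    intro i j hij
    rw [Finset.disjoint_left]
    intro e he he'
    exact Set.disjoint_left.1 (hTd i j hij) (hBT i ((hmem i e).1 he)) (hBT j ((hmem j e).1 he'))
  have hcard : ∀ i, (B' i).card + 1 = V.card := by
    intro i
    refine le_antisymm (card_lt_of_linearIndepOn (s := s) (t := t) hV (fun e he => ?_) ?_)
      (Connects.card_le (s := s) (t := t) ?_)
    · exact (hT i e (hBT i ((hmem i e).1 he))).2
    · rw [hB']; exact hBind i
    · rw [hB']; exact hBc i
  refine ⟨Finset.univ.biUnion B', ?_, ?_, ?_⟩
  · exact Finset.biUnion_subset.2 fun i _ => Finset.filter_subset _ _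
  · intro W hW
    have h1 : edgesIn s t (Finset.univ.biUnion B') W =
        Finset.univ.biUnion fun i => edgesIn s t (B' i) W := by
      ext e
      simp
    have h2 : ∀ i, (edgesIn s t (B' i) W).card + 1 ≤ W.card := by
      intro i
      refine card_lt_of_linearIndepOn (s := s) (t := t) hW (fun e he => (mem_edgesIn.1 he).2)
        ((hBind i).mono fun e he => (hmem i e).1 (mem_edgesIn.1 he).1)
    have h3 : ∑ i : Fin m, ((edgesIn s t (B' i) W).card + 1) ≤ ∑ _i : Fin m, W.card :=
      Finset.sum_le_sum fun i _ => h2 i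
    rw [Finset.sum_add_distrib] at h3
    simp only [Finset.sum_const, Finset.card_univ, Fintype.card_fin, smul_eq_mul, mul_one] at h3
    have h4 := Finset.card_biUnion_le (s := Finset.univ) (t := fun i => edgesIn s t (B' i) W)
    rw [h1]
    omega
  · rw [Finset.card_biUnion fun i _ j _ hij => hdisj i j hij]
    have h3 : ∑ i : Fin m, ((B' i).card + 1) = ∑ _i : Fin m, V.card :=
      Finset.sum_congr rfl fun i _ => hcard i
    rw [Finset.sum_add_distrib] at h3
    simpa using h3

/-- If all edges of `E` inside `D` that are not in `H` lie in tight sets inside `D`, and `D` is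
packed by edges of `E`, then `D` is tight in `H`. -/
theorem IsTreePacked.mul_card_le (hm : 0 < m) {E : Set β} {H : Finset β} {D : Finset α}
    (hH : IsSparse s t m H) (hD : IsTreePacked s t m E (D : Set α))
    (hC : ∀ e ∈ E, e ∉ H → s e ∈ D → t e ∈ D →
      ∃ C ⊆ D, IsTight s t m H C ∧ s e ∈ C ∧ t e ∈ C) :
    m * D.card ≤ (edgesIn s t H D).card + m := by
  classical
  obtain ⟨c, hc⟩ := hH.exists_coloring hm
  obtain ⟨-, T, hT, hTd, hTc⟩ := hD
  let J : β → Prop := fun e => ∃ C ⊆ D, IsTight s t m H C ∧ s e ∈ C ∧ t e ∈ C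
  -- In each packing set, edges lying in tight sets are replaced by the forest of colour `i` there,
  -- which still joins their ends. The other edges are already in `H`, so this packs `D` by edges of
  -- `H`.
  let A : Fin m → Finset β := fun i =>
    (edgesIn s t H D).filter fun e => (¬ J e ∧ e ∈ T i) ∨ (J e ∧ c e = i)
  have hAc : ∀ i, Connects s t (A i : Set β) (D : Set α) := by
    intro i x hx y hy
    refine (hTc i x hx y hy).of_forall fun e he => ?_
    obtain ⟨heE, hs, ht⟩ := hT i e he
    by_cases hJ : J e
    · obtain ⟨C, hCD, hCt, hsC, htC⟩ := hJ
      refine (connects_of_tight hc hCt.1 hCt.2.ge i _ hsC _ htC).mono ?_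
      rintro f ⟨hf, hfi⟩
      rw [mem_edgesIn] at hf
      refine Finset.mem_coe.2 (Finset.mem_filter.2 ⟨mem_edgesIn.2 ⟨hf.1, hCD hf.2.1, hCD hf.2.2⟩,
        Or.inr ⟨⟨C, hCD, hCt, hf.2⟩, hfi⟩⟩)
    · have heH : e ∈ H := by
        by_contra heH
        exact hJ (hC e heE heH hs ht)
      exact .of_mem (Finset.mem_coe.2 (Finset.mem_filter.2
        ⟨mem_edgesIn.2 ⟨heH, hs, ht⟩, Or.inl ⟨hJ, he⟩⟩))
  have hAd : ∀ i ∈ (Finset.univ : Finset (Fin m)), ∀ j ∈ (Finset.univ : Finset (Fin m)),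
      i ≠ j → Disjoint (A i) (A j) := by
    intro i _ j _ hij
    rw [Finset.disjoint_left]
    intro e he he'
    rcases (Finset.mem_filter.1 he).2 with h | h <;> rcases (Finset.mem_filter.1 he').2 with h' | h'
    · exact Set.disjoint_left.1 (hTd i j hij) h.2 h'.2
    · exact h.1 h'.1
    · exact h'.1 h.1
    · exact hij (h.2.symm.trans h'.2)
  have h1 : ∑ _i : Fin m, D.card ≤ ∑ i : Fin m, ((A i).card + 1) :=
    Finset.sum_le_sum fun i _ => (hAc i).card_le
  rw [Finset.sum_add_distrib, ← Finset.card_biUnion hAd] at h1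
  simp only [Finset.sum_const, Finset.card_univ, Fintype.card_fin, smul_eq_mul, mul_one] at h1
  have h2 : (Finset.univ.biUnion A).card ≤ (edgesIn s t H D).card :=
    Finset.card_le_card (Finset.biUnion_subset.2 fun i _ => Finset.filter_subset _ _)
  omega

/-- Counting the edges of `H` by the number of their ends in `S`. -/
theorem card_edgesIn_sdiff_add_sum_edgeDegree_le [DecidableEq α] (H : Finset β)
    (V S : Finset α) :
    (edgesIn s t H (V \ S)).card + ∑ v ∈ S, edgeDegree s t H v ≤
      H.card + (edgesIn s t H S).card := by
  classical
  have h1 : ∑ v ∈ S, edgeDegree s t H v = ∑ e ∈ H, (S.filter fun v => s e = v ∨ t e = v).card := by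
    simp only [edgeDegree, Finset.card_filter]
    rw [Finset.sum_comm]
    refine Finset.sum_congr rfl fun e _ => Finset.sum_congr rfl fun v _ => ?_
    congr
  rw [h1, edgesIn, edgesIn, Finset.card_filter, Finset.card_filter, Finset.card_eq_sum_ones,
    ← Finset.sum_add_distrib, ← Finset.sum_add_distrib]
  -- For a single edge: the number of distinct ends in `S`, plus one if both ends lie in `V \ S`, is
  -- at most one, or two if both ends lie in `S`.
  refine Finset.sum_le_sum fun e _ => ?_
  have h2 : (S.filter fun v => s e = v ∨ t e = v) = S ∩ {s e, t e} := by
    ext v; simp [eq_comm]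
  rw [h2]
  have h3 : (S ∩ {s e, t e}).card ≤ 2 := (Finset.card_le_card Finset.inter_subset_right).trans
    Finset.card_le_two
  have h4 : ∀ x, S ∩ {s e, t e} ⊆ {x} → (S ∩ {s e, t e}).card ≤ 1 := fun x hx =>
    (Finset.card_le_card hx).trans (by simp)
  by_cases hs : s e ∈ S <;> by_cases ht : t e ∈ S
  · rw [if_neg (by simp [hs]), if_pos ⟨hs, ht⟩]
    omega
  · have := h4 (s e) (by intro x; simp only [Finset.mem_inter, Finset.mem_insert,
      Finset.mem_singleton]; grind)
    rw [if_neg (by simp [hs])]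
    omega
  · have := h4 (t e) (by intro x; simp only [Finset.mem_inter, Finset.mem_insert,
      Finset.mem_singleton]; grind)
    rw [if_neg (by simp [ht])]
    omega
  · have : S ∩ {s e, t e} = ∅ := by
      ext x; simp only [Finset.mem_inter, Finset.mem_insert, Finset.mem_singleton]; grind
    rw [this, Finset.card_empty]
    split_ifs <;> omega

end Packing

/-! ### Translation to graphs and the lower bound for Ω. -/

namespace Graph

variable {α β : Type*} {s t : β → α} {m : ℕ}

/-- With signs following the direction of travel, the edge vectors telescope to zero around a cycle.
-/
theorem IsCycle.not_linearIndepOn {K : Graph α β} (hst : ∀ e ∈ E(K), K.IsLink e (s e) (t e))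
    {n : ℕ} {v : Fin (n + 1) → α} {e : Fin (n + 1) → β} (hc : K.IsCycle n v e) :
    ¬ LinearIndepOn ℚ (edgeVec s t) E(K) := by
  intro hind
  obtain ⟨-, he, hl⟩ := hc
  have hli : LinearIndependent ℚ fun i => edgeVec s t (e i) :=
    LinearIndependent.comp (ι := E(K)) (v := fun x => edgeVec s t x) hind
      (fun i => ⟨e i, (hl i).edge_mem⟩) fun i j h => he (congrArg Subtype.val h)
  have hsign : ∀ i, ∃ a : ℚ, a ≠ 0 ∧ a • edgeVec s t (e i) =
      Finsupp.single (v i) 1 - Finsupp.single (v (i + 1)) 1 := by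
    intro i
    rcases (hst _ (hl i).edge_mem).eq_and_eq_or_eq_and_eq (hl i) with ⟨h1, h2⟩ | ⟨h1, h2⟩
    · exact ⟨1, one_ne_zero, by simp [edgeVec, h1, h2]⟩
    · exact ⟨-1, by simp, by simp [edgeVec, h1, h2]⟩
  choose a ha hav using hsign
  refine ha 0 (Fintype.linearIndependent_iff.1 hli a ?_ 0)
  simp only [hav, Finset.sum_sub_distrib]
  rw [sub_eq_zero]
  exact (Equiv.sum_comp (Equiv.addRight (1 : Fin (n + 1)))
    fun i => (Finsupp.single (v i) 1 : α →₀ ℚ)).symm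

/-- Tree-connectivity in terms of incidence vectors. -/
theorem isTreeConnected_iff (hm : 0 < m) {K : Graph α β}
    (hst : ∀ e ∈ E(K), K.IsLink e (s e) (t e)) :
    K.IsTreeConnected m ↔ IsTreePacked s t m E(K) V(K) := by
  constructor
  · rintro ⟨T, hT, hd⟩
    refine ⟨?_, fun i => E(T i), fun i e he => ?_, hd, fun i x hx y hy => ?_⟩
    · rw [← (hT ⟨0, hm⟩).1.vertexSet_eq]
      exact (hT ⟨0, hm⟩).2.1.1
    · have he' := (hT i).1.le.edgeSet_mono he
      exact ⟨he', (hst e he').left_mem, (hst e he').right_mem⟩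
    · rw [← (hT i).1.vertexSet_eq] at hx hy
      refine joined_of_reflTransGen (Relation.ReflTransGen.mono ?_ _ _
        ((hT i).2.1.2 x hx y hy))
      rintro a b ⟨e, he⟩
      exact ⟨e, he.edge_mem, (hst e (he.mono (hT i).1.le).edge_mem).eq_and_eq_or_eq_and_eq
        (he.mono (hT i).1.le)⟩
  · rintro ⟨hV, T, hT, hd, hTc⟩
    choose B hBT hBind hBc using fun i => (hTc i).exists_independent_subset
    refine ⟨fun i => K.restrict (B i), fun i => ⟨⟨restrict_le, rfl⟩, ⟨hV, fun x hx y hy => ?_⟩,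
      fun n v e hc => ?_⟩, fun i j hij => ?_⟩
    · refine Relation.ReflTransGen.mono ?_ _ _ (hBc i x hx y hy).reflTransGen
      rintro a b ⟨e, he, h⟩
      have hl := hst e (hT i e (hBT i he)).1
      rcases h with ⟨rfl, rfl⟩ | ⟨rfl, rfl⟩
      · exact ⟨e, he, hl⟩
      · exact ⟨e, he, hl.symm⟩
    · refine hc.not_linearIndepOn (s := s) (t := t) (fun e he => ?_)
        ((hBind i).mono fun e he => ?_)
      · exact ⟨he.2, hst e he.1⟩
      · exact he.2
    · exact (hd i j hij).mono (fun e he => hBT i he.2) (fun e he => hBT j he.2)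

variable {G : Graph α β}

theorem isTreeConnected_induce_deleteVerts_iff (hm : 0 < m)
    (hst : ∀ e ∈ E(G), G.IsLink e (s e) (t e)) {S D : Set α} (hD : D ⊆ V(G) \ S) :
    ((G.deleteVerts S).induce D).IsTreeConnected m ↔ IsTreePacked s t m E(G) D := by
  have hl : ∀ e x y, ((G.deleteVerts S).induce D).IsLink e x y ↔
      G.IsLink e x y ∧ x ∈ D ∧ y ∈ D := by
    intro e x y
    rw [induce_isLink, deleteVerts_isLink]
    have h1 := @hD x
    have h2 := @hD y
    simp only [Set.mem_sdiff] at h1 h2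
    tauto
  have hE : ∀ e, e ∈ E((G.deleteVerts S).induce D) ↔ e ∈ E(G) ∧ s e ∈ D ∧ t e ∈ D := by
    intro e
    rw [edge_mem_iff_exists_isLink]
    simp only [hl]
    constructor
    · rintro ⟨x, y, h, hx, hy⟩
      refine ⟨h.edge_mem, ?_⟩
      rcases h.eq_and_eq_or_eq_and_eq (hst e h.edge_mem) with ⟨rfl, rfl⟩ | ⟨rfl, rfl⟩
      exacts [⟨hx, hy⟩, ⟨hy, hx⟩]
    · rintro ⟨h, hs, ht⟩
      exact ⟨_, _, hst e h, hs, ht⟩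
  rw [isTreeConnected_iff (s := s) (t := t) hm fun e he =>
    (hl _ _ _).2 ⟨hst e ((hE e).1 he).1, ((hE e).1 he).2⟩]
  unfold IsTreePacked
  simp only [hE, vertexSet_induce]
  refine and_congr_right fun _ => exists_congr fun T => and_congr_left fun _ =>
    forall_congr' fun i => forall₂_congr fun e _ => ?_
  tauto

/-- If the edges outside a tree base avoiding `S` are covered by tight sets avoiding `S`, then
`m * Ω_m (G \ S)` is at least `m * |V \ S|` minus the number of edges of the base avoiding `S`. -/
theorem mul_card_add_numCrossing_le (hm : 0 < m) (hst : ∀ e ∈ E(G), G.IsLink e (s e) (t e))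
    [DecidableEq α] {V S : Finset α} {E H : Finset β} (hV : (V : Set α) = V(G))
    (hE : (E : Set β) = E(G)) (hH : IsTreeBase s t m V E H)
    (hS : ∀ e ∈ E, e ∉ H → s e ∉ S → t e ∉ S →
      ∃ C ⊆ V, IsTight s t m H C ∧ Disjoint C S ∧ s e ∈ C ∧ t e ∈ C) :
    m * (V \ S).card +
        (G.deleteVerts (S : Set α)).numCrossing ((G.deleteVerts (S : Set α)).treeComponents m) ≤
      m * ((G.deleteVerts (S : Set α)).treeComponents m).ncard +
        (edgesIn s t H (V \ S)).card := by
  classical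
  have hHE : (H : Set β) ⊆ E(G) := by
    rw [← hE]
    exact Finset.coe_subset.2 hH.subset
  have hVS : V(G) \ (S : Set α) = ((V \ S : Finset α) : Set α) := by
    rw [Finset.coe_sdiff, hV]
  set P := (G.deleteVerts (S : Set α)).treeComponents m with hPdef
  have hPiff : ∀ D : Set α, D ⊆ V(G.deleteVerts (S : Set α)) ∧
      ((G.deleteVerts (S : Set α)).induce D).IsTreeConnected m ↔
      D ⊆ ((V \ S : Finset α) : Set α) ∧ IsTreePacked s t m E(G) D := by
    intro D
    rw [vertexSet_deleteVerts, ← hVS]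
    exact and_congr_right fun hD => isTreeConnected_induce_deleteVerts_iff hm hst hD
  have hPmem : ∀ D : Set α, D ∈ P ↔ Maximal (fun D : Set α =>
      D ⊆ ((V \ S : Finset α) : Set α) ∧ IsTreePacked s t m E(G) D) D := by
    intro D
    simp only [hPdef, treeComponents, Set.mem_ofPred_eq, hPiff]
  -- Components absorb every packed set they meet. This gives disjointness, and puts each tight set
  -- avoiding `S` inside one component.
  have hmax : ∀ D ∈ P, ∀ C : Set α, C ⊆ ((V \ S : Finset α) : Set α) →
      IsTreePacked s t m E(G) C → ∀ x ∈ C, x ∈ D → C ⊆ D := by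
    intro D hD C hCV hC x hxC hxD
    have hD' := (hPmem D).1 hD
    exact Set.subset_union_left.trans
      (hD'.2 ⟨Set.union_subset hCV hD'.1.1, hC.union hD'.1.2 hxC hxD⟩ Set.subset_union_right)
  have hdisj : ∀ D ∈ P, ∀ D' ∈ P, ∀ x ∈ D, x ∈ D' → D = D' := by
    intro D hD D' hD' x hx hx'
    have h1 := ((hPmem D).1 hD).1
    have h2 := ((hPmem D').1 hD').1
    exact (hmax D' hD' D h1.1 h1.2 x hx hx').antisymm (hmax D hD D' h2.1 h2.2 x hx' hx)
  have hcover : ∀ x ∈ V \ S, ∃ D ∈ P, x ∈ D := by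
    intro x hx
    have hfin : {D : Set α | D ⊆ ((V \ S : Finset α) : Set α) ∧
        IsTreePacked s t m E(G) D}.Finite :=
      (V \ S).finite_toSet.finite_subsets.subset fun D hD => hD.1
    obtain ⟨D, hxD, hD⟩ := hfin.exists_le_maximal (a := {x})
      ⟨Set.singleton_subset_iff.2 (Finset.mem_coe.2 hx), isTreePacked_singleton _ x⟩
    exact ⟨D, (hPmem D).2 hD, hxD rfl⟩
  let Pf : Finset (Finset α) := (V \ S).powerset.filter fun D => (D : Set α) ∈ P
  have hPf : ∀ D ∈ Pf, D ⊆ V \ S ∧ (D : Set α) ∈ P := fun D hD =>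
    ⟨Finset.mem_powerset.1 (Finset.mem_filter.1 hD).1, (Finset.mem_filter.1 hD).2⟩
  have hPPf : ∀ D ∈ P, ∃ D' ∈ Pf, (D' : Set α) = D := by
    intro D hD
    have hsub := ((hPmem D).1 hD).1.1
    have hfin : D.Finite := (V \ S).finite_toSet.subset hsub
    refine ⟨hfin.toFinset, Finset.mem_filter.2 ⟨Finset.mem_powerset.2 ?_, ?_⟩, hfin.coe_toFinset⟩
    · exact hfin.toFinset_subset.2 hsub
    · rwa [hfin.coe_toFinset]
  have hncard : P.ncard = Pf.card := by
    have : P = (fun D : Finset α => (D : Set α)) '' (Pf : Set (Finset α)) := by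
      ext D
      constructor
      · intro hD
        obtain ⟨D', hD', rfl⟩ := hPPf D hD
        exact ⟨D', hD', rfl⟩
      · rintro ⟨D', hD', rfl⟩
        exact (hPf D' hD').2
    rw [this, Set.ncard_image_of_injective _ Finset.coe_injective, Set.ncard_coe_finset]
  have htight : ∀ D ∈ Pf, m * D.card ≤ (edgesIn s t H D).card + m := by
    intro D hD
    obtain ⟨hDV, hDP⟩ := hPf D hD
    refine (((hPmem _).1 hDP).1.2).mul_card_le hm hH.sparse fun e heE heH hs ht => ?_
    have heE' : e ∈ E := by rwa [← hE] at heE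
    obtain ⟨C, hCV, hC, hCS, hsC, htC⟩ := hS e heE' heH (Finset.mem_sdiff.1 (hDV hs)).2
      (Finset.mem_sdiff.1 (hDV ht)).2
    refine ⟨C, ?_, hC, hsC, htC⟩
    exact Finset.coe_subset.1 (hmax _ hDP _ (Finset.coe_subset.2 (Finset.subset_sdiff.2 ⟨hCV, hCS⟩))
      (hC.isTreePacked hm hH.sparse hHE) _ hsC hs)
  have hcardV : (V \ S).card ≤ ∑ D ∈ Pf, D.card := by
    refine (Finset.card_le_card fun x hx => ?_).trans
      (Finset.card_biUnion_le (s := Pf) (t := fun D => D))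
    obtain ⟨D, hD, hxD⟩ := hcover x hx
    obtain ⟨D', hD', rfl⟩ := hPPf D hD
    exact Finset.mem_biUnion.2 ⟨D', hD', hxD⟩
  let X : Set β := {e | ∃ x y, (G.deleteVerts (S : Set α)).IsLink e x y ∧
    ∃ A ∈ P, ∃ B ∈ P, A ≠ B ∧ x ∈ A ∧ y ∈ B}
  have hends : ∀ e ∈ X, e ∈ edgesIn s t H (V \ S) ∧ ∀ D ∈ P, s e ∈ D → t e ∉ D := by
    rintro e ⟨x, y, hl, A, hA, B, hB, hAB, hxA, hyB⟩
    rw [deleteVerts_isLink] at hl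
    obtain ⟨hl, hxS, hyS⟩ := hl
    have heE : e ∈ E := by
      rw [← Finset.mem_coe, hE]
      exact hl.edge_mem
    have hxV : x ∈ V := by rw [← Finset.mem_coe, hV]; exact hl.left_mem
    have hyV : y ∈ V := by rw [← Finset.mem_coe, hV]; exact hl.right_mem
    have hsep : ∀ D ∈ P, x ∈ D → y ∉ D := fun D hD hxD hyD =>
      hAB ((hdisj A hA D hD x hxA hxD).trans (hdisj D hD B hB y hyD hyB))
    have hcase := hl.eq_and_eq_or_eq_and_eq (hst e hl.edge_mem)
    -- An edge outside `H` lies in a tight set avoiding `S`, hence within one component, and cannot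
    -- cross.
    have heH : e ∈ H := by
      by_contra heH
      have hC : ∃ C ⊆ V, IsTight s t m H C ∧ Disjoint C S ∧ x ∈ C ∧ y ∈ C := by
        rcases hcase with ⟨rfl, rfl⟩ | ⟨rfl, rfl⟩
        · exact hS e heE heH hxS hyS
        · obtain ⟨C, h1, h2, h3, h4, h5⟩ := hS e heE heH hyS hxS
          exact ⟨C, h1, h2, h3, h5, h4⟩
      obtain ⟨C, hCV, hC, hCS, hxC, hyC⟩ := hC
      exact hsep A hA hxA (hmax A hA _ (Finset.coe_subset.2 (Finset.subset_sdiff.2 ⟨hCV, hCS⟩))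
        (hC.isTreePacked hm hH.sparse hHE) _ hxC hxA hyC)
    have hx' : x ∈ V \ S := Finset.mem_sdiff.2 ⟨hxV, hxS⟩
    have hy' : y ∈ V \ S := Finset.mem_sdiff.2 ⟨hyV, hyS⟩
    rcases hcase with ⟨rfl, rfl⟩ | ⟨rfl, rfl⟩
    · exact ⟨mem_edgesIn.2 ⟨heH, hx', hy'⟩, hsep⟩
    · exact ⟨mem_edgesIn.2 ⟨heH, hy', hx'⟩, fun D hD h1 h2 => hsep D hD h2 h1⟩
  let Xf : Finset β := (edgesIn s t H (V \ S)).filter fun e => e ∈ X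
  have hXcard : X.ncard ≤ Xf.card := by
    rw [← Set.ncard_coe_finset]
    refine Set.ncard_le_ncard (fun e he => ?_) (Finset.finite_toSet _)
    exact Finset.mem_coe.2 (Finset.mem_filter.2 ⟨(hends e he).1, he⟩)
  have hsum : ∑ D ∈ Pf, (edgesIn s t H D).card + Xf.card ≤ (edgesIn s t H (V \ S)).card := by
    have hd : ∀ D ∈ Pf, ∀ D' ∈ Pf, D ≠ D' → Disjoint (edgesIn s t H D) (edgesIn s t H D') := by
      intro D hD D' hD' hne
      rw [Finset.disjoint_left]
      intro e he he'
      exact hne (Finset.coe_injective (hdisj _ (hPf D hD).2 _ (hPf D' hD').2 (s e)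
        (mem_edgesIn.1 he).2.1 (mem_edgesIn.1 he').2.1))
    rw [← Finset.card_biUnion hd, ← Finset.card_union_of_disjoint]
    · refine Finset.card_le_card (Finset.union_subset (Finset.biUnion_subset.2 fun D hD => ?_)
        (Finset.filter_subset _ _))
      exact edgesIn_mono (hPf D hD).1
    · rw [Finset.disjoint_left]
      intro e he heX
      obtain ⟨D, hD, heD⟩ := Finset.mem_biUnion.1 he
      rw [mem_edgesIn] at heD
      exact (hends e (Finset.mem_filter.1 heX).2).2 D (hPf D hD).2 heD.2.1 heD.2.2
  have hnum : (G.deleteVerts (S : Set α)).numCrossing P = X.ncard := rfl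
  have h1 : ∑ D ∈ Pf, m * D.card ≤ ∑ D ∈ Pf, ((edgesIn s t H D).card + m) :=
    Finset.sum_le_sum htight
  rw [← Finset.mul_sum, Finset.sum_add_distrib, Finset.sum_const, smul_eq_mul] at h1
  have h2 := Nat.mul_le_mul_left m hcardV
  rw [hnum, hncard, mul_comm m Pf.card]
  omega

theorem degree_restrict (hst : ∀ e ∈ E(G), G.IsLink e (s e) (t e)) {H : Finset β}
    (hH : (H : Set β) ⊆ E(G)) (v : α) :
    (G.restrict (H : Set β)).degree v = edgeDegree s t H v := by
  classical
  rw [degree, edgeDegree, ← Set.ncard_coe_finset]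
  congr 1
  ext e
  simp only [mem_incidenceSet, restrict_inc, Finset.coe_filter, Set.mem_ofPred_eq, Finset.mem_coe]
  constructor
  · rintro ⟨he, heH⟩
    refine ⟨heH, ?_⟩
    rcases he.eq_or_eq_of_isLink (hst e (hH heH)) with h | h
    exacts [Or.inl h.symm, Or.inr h.symm]
  · rintro ⟨heH, rfl | rfl⟩
    exacts [⟨(hst e (hH heH)).inc_left, heH⟩, ⟨(hst e (hH heH)).inc_right, heH⟩]

theorem isTreeConnected_restrict (hm : 0 < m) (hst : ∀ e ∈ E(G), G.IsLink e (s e) (t e))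
    {V : Finset α} {E H : Finset β} (hV : (V : Set α) = V(G)) (hE : (E : Set β) = E(G))
    (hVne : V.Nonempty) (hH : IsTreeBase s t m V E H) :
    (G.restrict (H : Set β)).IsTreeConnected m := by
  have hHE : (H : Set β) ⊆ E(G) := by
    rw [← hE]
    exact Finset.coe_subset.2 hH.subset
  have hEV : ∀ e ∈ E, s e ∈ V ∧ t e ∈ V := by
    intro e he
    rw [← Finset.mem_coe, hE] at he
    rw [← Finset.mem_coe, ← Finset.mem_coe, hV]
    exact ⟨(hst e he).left_mem, (hst e he).right_mem⟩
  refine (isTreeConnected_iff (K := G.restrict (H : Set β)) (s := s) (t := t) hm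
    fun e he => ⟨he.2, hst e he.1⟩).2 ?_
  have := (hH.isTight hVne hEV).isTreePacked hm hH.sparse
    (E := E(G.restrict (H : Set β))) fun e he => ⟨hHE he, he⟩
  rwa [hV] at this

end Graph

/-! ### The final count and the theorem. -/

/-- Here n = |V|, σ = |S|, p = |P|, q = e(P), a is the degree sum of H over S, b = e_H(S), c = e_H(V
- S), i = e_G(S), w is the sum of η and l = λ. After multiplying by M, the slack left by the counts
is at least (1 - Ml)(Mσ - M - b), which is nonnegative because λ is at most 1/m and H is sparse on
S. -/
theorem bound_le_of_counts {M n σ a b c p q i l : ℝ} (hM : 0 < M) (hl : l ≤ 1 / M)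
    (h0 : 0 ≤ l)
    (hcount : M * (n - σ) + q ≤ M * p + c) (hdeg : c + a ≤ M * (n - 1) + b)
    (hb : b + M ≤ M * σ) (hbi : b ≤ i) {w : ℝ} (ha : M * w - M ^ 2 * l * σ + 1 ≤ a) :
    1 / M + (w - 2 * σ) + 2 - l * (i + M) ≤ p - 1 / M * q := by
  have hMl : M * l ≤ 1 := by
    have := mul_le_mul_of_nonneg_left hl hM.le
    rwa [mul_one_div_cancel hM.ne'] at this
  refine le_of_mul_le_mul_left ?_ hM
  have e1 : M * (1 / M + (w - 2 * σ) + 2 - l * (i + M)) =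
      1 + M * w - 2 * M * σ + 2 * M - M * l * i - M ^ 2 * l := by
    field_simp
    ring
  have e2 : M * (p - 1 / M * q) = M * p - q := by
    field_simp
  rw [e1, e2]
  have h1 : M * l * b ≤ M * l * i := mul_le_mul_of_nonneg_left hbi (by positivity)
  have h2 : 0 ≤ (1 - M * l) * (M * σ - M - b) :=
    mul_nonneg (by linarith) (by linarith)
  nlinarith

theorem mainTheorem3 {α β : Type*} (G : Graph α β) [G.Loopless]
    (hV : V(G).Finite) (hE : E(G).Finite)
    (m : ℕ) (hm : 0 < m) (hG : G.IsTreeConnected m)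
    (X : Set α) (hX : X ⊆ V(G))
    (lam : ℝ) (hlam : lam ∈ Set.Icc (0 : ℝ) (1 / (m : ℝ)))
    (η : α → ℝ) (hη : ∀ v ∈ X, (m : ℝ) * lam + ((m : ℝ) - 1) / (m : ℝ) < η v)
    (hS : ∀ S : Finset α, (S : Set α) ⊆ X →
      Graph.Omega m (G.deleteVerts (S : Set α)) <
        1 / (m : ℝ) + ∑ v ∈ S, (η v - 2) + 2
          - lam * ((G.numInside (S : Set α) : ℝ) + (m : ℝ))) :
    ∃ H : Graph α β, H.IsSpanningSubgraph G ∧ H.IsTreeConnected m ∧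
      ∀ v ∈ X, (H.degree v : ℤ) ≤ ⌈(m : ℝ) * η v - (m : ℝ) ^ 2 * lam⌉ := by
  classical
  have hM : (0 : ℝ) < m := Nat.cast_pos.2 hm
  obtain ⟨x₀, hx₀⟩ : V(G).Nonempty := by
    obtain ⟨T, hT, -⟩ := hG
    rw [← (hT ⟨0, hm⟩).1.vertexSet_eq]
    exact (hT ⟨0, hm⟩).2.1.1
  have hends : ∀ e, ∃ p : α × α, e ∈ E(G) → G.IsLink e p.1 p.2 := by
    intro e
    by_cases he : e ∈ E(G)
    · obtain ⟨x, y, h⟩ := G.exists_isLink_of_mem_edgeSet he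
      exact ⟨(x, y), fun _ => h⟩
    -- Non-edges receive arbitrary ends; only edges of `G` are ever used.
    · exact ⟨(x₀, x₀), fun h => absurd h he⟩
  choose p hp using hends
  obtain ⟨s, t, hst⟩ : ∃ s t : β → α, ∀ e ∈ E(G), G.IsLink e (s e) (t e) :=
    ⟨fun e => (p e).1, fun e => (p e).2, hp⟩
  obtain ⟨V, hVG⟩ : ∃ V : Finset α, (V : Set α) = V(G) := ⟨hV.toFinset, hV.coe_toFinset⟩
  obtain ⟨E, hEG⟩ : ∃ E : Finset β, (E : Set β) = E(G) := ⟨hE.toFinset, hE.coe_toFinset⟩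
  have hVmem : ∀ v, v ∈ V ↔ v ∈ V(G) := fun v => by rw [← hVG, Finset.mem_coe]
  have hEmem : ∀ e, e ∈ E ↔ e ∈ E(G) := fun e => by rw [← hEG, Finset.mem_coe]
  have hEV : ∀ e ∈ E, s e ∈ V ∧ t e ∈ V := fun e he => by
    have hl := hst e ((hEmem e).1 he)
    exact ⟨(hVmem _).2 hl.left_mem, (hVmem _).2 hl.right_mem⟩
  have hVne : V.Nonempty := ⟨x₀, (hVmem x₀).2 hx₀⟩
  -- degree bounds, trivial outside `X`
  let h : α → ℕ := fun v =>
    if v ∈ X then ⌈(m : ℝ) * η v - (m : ℝ) ^ 2 * lam⌉.toNat else E.card + 1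
  have hhX : ∀ v ∈ X, (h v : ℤ) = ⌈(m : ℝ) * η v - (m : ℝ) ^ 2 * lam⌉ := by
    intro v hv
    simp only [h, if_pos hv]
    -- The lower bound on `η` makes the expression exceed m - 1, so truncation to naturals is
    -- harmless.
    refine Int.toNat_of_nonneg (Int.ceil_nonneg ?_)
    have h1 := mul_lt_mul_of_pos_left (hη v hv) hM
    have h2 : (m : ℝ) * ((m : ℝ) * lam + ((m : ℝ) - 1) / (m : ℝ)) =
        (m : ℝ) ^ 2 * lam + ((m : ℝ) - 1) := by
      field_simp
    have h3 : (1 : ℝ) ≤ m := Nat.one_le_cast.2 hm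
    linarith
  have hpacked : IsTreePacked s t m (E : Set β) (V : Set α) := by
    rw [hVG, hEG]
    exact (Graph.isTreeConnected_iff hm hst).1 hG
  obtain ⟨H, hH, hmin⟩ : ∃ H, IsTreeBase s t m V E H ∧ ∀ H', IsTreeBase s t m V E H' →
      totalExcess s t V h H ≤ totalExcess s t V h H' := by
    obtain ⟨H₀, hH₀⟩ := hpacked.exists_isTreeBase
    have hne : {H | IsTreeBase s t m V E H}.Nonempty := ⟨H₀, hH₀⟩
    exact ⟨Function.argminOn (totalExcess s t V h) _ hne, Function.argminOn_mem _ _ hne,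
      fun H' hH' => Function.argminOn_le _ _ hH'⟩
  have hHE : (H : Set β) ⊆ E(G) := hEG ▸ Finset.coe_subset.2 hH.subset
  refine ⟨G.restrict (H : Set β), ⟨Graph.restrict_le, rfl⟩,
    Graph.isTreeConnected_restrict hm hst hVG hEG hVne hH, fun v hv => ?_⟩
  rw [Graph.degree_restrict hst hHE, ← hhX v hv, Nat.cast_le]
  by_contra hlt
  push Not at hlt
  obtain ⟨S, hSV, hviol, hsat, hcov⟩ := exists_saturated_set hm hH hEV hmin
  have hvS : v ∈ S := hviol v ((hVmem v).2 (hX hv)) hlt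
  -- A vertex of `S` attains its bound, while outside `X` the bound exceeds the number of edges.
  have hSX : (S : Set α) ⊆ X := by
    intro u hu
    by_contra huX
    have h1 := hsat u hu
    simp only [h, if_neg huX] at h1
    have h2 : edgeDegree s t H u ≤ H.card := Finset.card_filter_le _ _
    have h3 := Finset.card_le_card hH.subset
    omega
  refine absurd (hS S hSX) (not_lt.2 ?_)
  rw [Finset.sum_sub_distrib, Finset.sum_const, nsmul_eq_mul, mul_comm (S.card : ℝ) 2]
  have hSne : S.Nonempty := ⟨v, hvS⟩
  have hcount := Graph.mul_card_add_numCrossing_le hm hst hVG hEG hH hcov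
  have hdeg := card_edgesIn_sdiff_add_sum_edgeDegree_le (s := s) (t := t) H V S
  have hsp := hH.sparse S hSne
  have hcard := hH.card_eq
  have hcardS := Finset.card_sdiff_add_card_eq_card hSV
  have hins : (edgesIn s t H S).card ≤ G.numInside (S : Set α) := by
    rw [Graph.numInside, ← Set.ncard_coe_finset]
    refine Set.ncard_le_ncard (fun e he => ?_) (hE.subset ?_)
    · rw [Finset.mem_coe, mem_edgesIn] at he
      exact ⟨_, _, hst e (hHE he.1), he.2⟩
    · rintro e ⟨x, y, hl, -⟩
      exact hl.edge_mem
  -- The strict violation at `v` contributes the 1, which becomes the term 1/m of the hypothesis.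
  have hsumN : ∑ u ∈ S, h u + 1 ≤ ∑ u ∈ S, edgeDegree s t H u :=
    Finset.sum_lt_sum hsat ⟨v, hvS, hlt⟩
  have hsumR : (m : ℝ) * ∑ u ∈ S, η u - (m : ℝ) ^ 2 * lam * S.card ≤ ∑ u ∈ S, (h u : ℝ) := by
    have : ∑ u ∈ S, ((m : ℝ) * η u - (m : ℝ) ^ 2 * lam) ≤ ∑ u ∈ S, (h u : ℝ) := by
      refine Finset.sum_le_sum fun u hu => (Int.le_ceil _).trans ?_
      rw [← hhX u (hSX hu), Int.cast_natCast]
    rw [Finset.sum_sub_distrib, ← Finset.mul_sum, Finset.sum_const, nsmul_eq_mul] at this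
    linarith
  have hcardS' : ((V \ S).card : ℝ) = V.card - S.card := by
    rw [← hcardS]; push_cast; ring
  have hcard' : (H.card : ℝ) = m * (V.card - 1) := by
    have : (H.card : ℝ) + m = m * V.card := by exact_mod_cast hcard
    linarith
  refine bound_le_of_counts (n := V.card) (a := ((∑ u ∈ S, edgeDegree s t H u : ℕ) : ℝ))
    (b := (edgesIn s t H S).card) (c := (edgesIn s t H (V \ S)).card) hM hlam.2 hlam.1 ?_ ?_ ?_ ?_ ?_
  · rw [← hcardS']
    exact_mod_cast hcount
  · rw [← hcard']
    exact_mod_cast hdeg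
  · exact_mod_cast hsp
  · exact_mod_cast hins
  · have : ((∑ u ∈ S, h u + 1 : ℕ) : ℝ) ≤ ((∑ u ∈ S, edgeDegree s t H u : ℕ) : ℝ) :=
      Nat.cast_le.2 hsumN
    push_cast at this ⊢
    linarith
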